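/- For $m\in\mathbb N$ and $t>0$ equip $\mathbb C^m$ with the matrix norms $$\|x\|_{M_k(K(t))}=\inf_{x=x_1+x_2+x_3}\big\{\|x_1\|_{M_k(\ell_\infty^m)}+\sqrt t\,\|x_2\|_{M_k(R^m+C^m)}+t\,\|x_3\|_{M_k(\ell_1^m)}\big\},\qquad x\in M_k(\mathbb C^m),\ k\ge 1,$$ where, for $x=\sum_j A_j\otimes e_j\in M_k\otimes\mathbb C^m$: $\|x\|_{M_k(\ell_\infty^m)}=\max_j\|A_j\|$; $\|x\|_{M_k(R^m)}=\|\sum_j A_jA_j^*\|^{1/2}$; $\|x\|_{M_k(C^m)}=\|\sum_j A_j^*A_j\|^{1/2}$; $\|x\|_{M_k(R^m+C^m)}=\inf_{x=y+z}\big(\|y\|_{M_k(R^m)}+\|z\|_{M_k(C^m)}\big)$; and $\|x\|_{M_k(\ell_1^m)}$ is the completely bounded norm of the map $\ell_\infty^m\to M_k$, $e_j\mapsto A_j$. For $q>2$ let $X_t^q=t^{-1/q}K(t;\ell_\infty^m,R^m+C^m,\ell_1^m)$, that is, $\mathbb C^m$ with the matrix norms $t^{-1/q}\|\cdot\|_{M_k(K(t))}$.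 For $a\in X\otimes X$ let $\|a\|_{\epsilon}=\sup|(\varphi\otimes\psi)(a)|$ over $\varphi,\psi$ in the unit ball of the dual of the Banach space $X$, and $\|a\|_{\min}=\sup\|(u\otimes v)(a)\|$ over all complete contractions $u:X\to M_k$, $v:X\to M_l$, $k,l\ge 1$. Theorem. For every $2<q<\infty$ there are constants $D(q),\kappa(q)>0$, depending only on $q$, such that for all integers $n\ge 1$ and $m$ with $n^{q/2}\le m\le 2n^{q/2}$ the following holds with $t=n/m$. There is a tensor $a\in X_t^q\otimes X_t^q$ of rank $n$ with $$\|a\|_{\epsilon}\le D(q)\qquad\text{and}\qquad \|a\|_{\min}\ge n^{\frac12-\frac2q}.$$ Moreover, if $G=\sum_{i=1}^n\sum_{j=1}^m g_{ij}\,e_i\otimes e_j:\ell_2^n\to\mathbb C^m$ with independent standard real Gaussian variables $g_{ij}$, then with positive probability the image of the identity $$a=\kappa(q)\,m^{-2/q}\,(G\otimes G)\Big(\sum_{i=1}^n e_i\otimes e_i\Big)=\kappa(q)\,m^{-2/q}\sum_{i=1}^n Ge_i\otimes Ge_i$$ has these three properties. -/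

import Mathlib

open MeasureTheory ProbabilityTheory
open scoped Kronecker Matrix

namespace OpSpace

noncomputable section

/-- The operator norm of a square complex matrix acting on the Hilbert space `ℓ₂`. -/
def opNorm {ι : Type*} [Fintype ι] [DecidableEq ι] (A : Matrix ι ι ℂ) : ℝ :=
  ‖Matrix.toEuclideanCLM (n := ι) (𝕜 := ℂ) A‖

/-- An element `∑ j, x j ⊗ e_j` of `M_k(ℂ^m) = M_k ⊗ ℂ^m`, given by its `m` coefficients. -/
abbrev MatTuple (m k : ℕ) : Type := Fin m → Matrix (Fin k) (Fin k) ℂ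

/-- A sequence of candidate norms on the spaces `M_k(ℂ^m)`, `k = 0, 1, 2, …`. -/
abbrev MatNorms (m : ℕ) : Type := ∀ k : ℕ, MatTuple m k → ℝ

/-- `M_k(ℓ_∞^m)`: the maximum of the norms of the coefficients. -/
def linfty (m : ℕ) : MatNorms m := fun _ x => ⨆ j, opNorm (x j)

/-- `M_k(R^m)`: `‖∑ x_j x_j^*‖^{1/2}`. -/
def row (m : ℕ) : MatNorms m := fun _ x => Real.sqrt (opNorm (∑ j, x j * (x j)ᴴ))

/-- `M_k(C^m)`: `‖∑ x_j^* x_j‖^{1/2}`. -/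
def col (m : ℕ) : MatNorms m := fun _ x => Real.sqrt (opNorm (∑ j, (x j)ᴴ * x j))

/-- `M_k(R^m + C^m)`: the infimum over all decompositions `x = y + z`. -/
def rowAddCol (m : ℕ) : MatNorms m := fun k x =>
  sInf {r : ℝ | ∃ y z : MatTuple m k, y + z = x ∧ r = row m k y + col m k z}

/-- The map `u_k = id ⊗ u : M_k(ℂ^m) → M_k(M_l) = M_{kl}` induced by the linear map
`u : ℂ^m → M_l` with `u e_j = U j`. -/
def amplify {m l : ℕ} (U : MatTuple m l) {k : ℕ} (x : MatTuple m k) :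
    Matrix (Fin k × Fin l) (Fin k × Fin l) ℂ :=
  ∑ j, x j ⊗ₖ U j

/-- The linear map `e_j ↦ U j` from `ℂ^m`, with the matrix norms `N`, to `M_l` is completely
contractive. -/
def IsCompleteContraction {m l : ℕ} (N : MatNorms m) (U : MatTuple m l) : Prop :=
  ∀ (k : ℕ) (x : MatTuple m k), opNorm (amplify U x) ≤ N k x

/-- `M_k(ℓ_1^m) = CB(ℓ_∞^m, M_k)`, the operator space dual of `ℓ_∞^m`: the norm of `x` is the
completely bounded norm of the map `ℓ_∞^m → M_k`, `e_j ↦ x j`. -/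
def lone (m : ℕ) : MatNorms m := fun _ x =>
  sSup {r : ℝ | ∃ (l : ℕ) (y : MatTuple m l), linfty m l y ≤ 1 ∧ r = opNorm (amplify x y)}

/-- `K(t; ℓ_∞^m, R^m + C^m, ℓ_1^m)`. -/
def kSpace (t : ℝ) (m : ℕ) : MatNorms m := fun k x =>
  sInf {r : ℝ | ∃ x₁ x₂ x₃ : MatTuple m k, x₁ + x₂ + x₃ = x ∧
    r = linfty m k x₁ + Real.sqrt t * rowAddCol m k x₂ + t * lone m k x₃}

/-- `X_t^q = t^{-1/q} K(t; ℓ_∞^m, R^m + C^m, ℓ_1^m)`. -/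
def xSpace (q t : ℝ) (m : ℕ) : MatNorms m := fun k x => t ^ (-1 / q) * kSpace t m k x

/-- The norm of the underlying Banach space, `M_1(ℂ^m) = ℂ^m`. -/
def baseNorm {m : ℕ} (N : MatNorms m) (x : Fin m → ℂ) : ℝ :=
  N 1 fun j => Matrix.of fun _ _ => x j

/-- The functional `x ↦ ∑ j, φ j * x j` lies in the unit ball of the dual Banach space. -/
def IsContractiveFunctional {m : ℕ} (N : MatNorms m) (φ : Fin m → ℂ) : Prop :=
  ∀ x : Fin m → ℂ, ‖∑ j, φ j * x j‖ ≤ baseNorm N x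

/-- The injective norm of `∑ a i j (e_i ⊗ e_j) ∈ X ⊗_ε X`. -/
def epsNorm {m : ℕ} (N : MatNorms m) (a : Matrix (Fin m) (Fin m) ℂ) : ℝ :=
  sSup {r : ℝ | ∃ φ ψ : Fin m → ℂ, IsContractiveFunctional N φ ∧ IsContractiveFunctional N ψ ∧
    r = ‖∑ i, ∑ j, a i j * (φ i * ψ j)‖}

/-- The minimal norm of `∑ a i j (e_i ⊗ e_j) ∈ X ⊗_min X`: the supremum of
`‖(u ⊗ v)(a)‖` over all complete contractions `u : X → M_k`, `v : X → M_l`. -/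
def minNorm {m : ℕ} (N : MatNorms m) (a : Matrix (Fin m) (Fin m) ℂ) : ℝ :=
  sSup {r : ℝ | ∃ (k l : ℕ) (U : MatTuple m k) (V : MatTuple m l),
    IsCompleteContraction N U ∧ IsCompleteContraction N V ∧
    r = opNorm (∑ i, ∑ j, a i j • (U i ⊗ₖ V j))}

/-- The law of an `n × m` matrix of independent standard real Gaussian variables. -/
def gaussianMatrix (n m : ℕ) : Measure (Fin n × Fin m → ℝ) :=
  Measure.pi fun _ => gaussianReal 0 1

/-- The image `∑ i, G e_i ⊗ G e_i` of the identity `∑ i, e_i ⊗ e_i ∈ ℓ_2^n ⊗ ℓ_2^n` under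
`G ⊗ G`, where `G e_i = ∑ j, g (i, j) e_j ∈ ℂ^m`. -/
def imageOfIdentity {n m : ℕ} (g : Fin n × Fin m → ℝ) : Matrix (Fin m) (Fin m) ℂ :=
  Matrix.of fun j k => ∑ i, (g (i, j) : ℂ) * (g (i, k) : ℂ)

/-- `a ∈ X_t^q ⊗ X_t^q`, with `t = n / m`, has rank `n`, injective norm at most `D`, and minimal
norm at least `n^{1/2 - 2/q}`. -/
def Separates (q D : ℝ) (n m : ℕ) (a : Matrix (Fin m) (Fin m) ℂ) : Prop :=
  a.rank = n ∧
  epsNorm (xSpace q ((n : ℝ) / m) m) a ≤ D ∧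
  (n : ℝ) ^ (1 / 2 - 2 / q) ≤ minNorm (xSpace q ((n : ℝ) / m) m) a

end

end OpSpace

namespace OpSpace

open scoped ENNReal ComplexOrder Matrix.Norms.L2Operator

/-! The argument is a first-order study of `G` with its rows tested on a `1/2`-net of the real
sphere. For a unit vector `ξ`, `Gξ` is a standard Gaussian vector in `ℝ^m`. Put `l = n^{1/q}`. Since
`m ≤ 2 n^{q/2}`, entries above `l` are so rare that the part of `Gξ` exceeding `l` has `ℓ₂` norm
`O(√n)`, uniformly over the net (`exists_regular`).

Injective norm: truncation at `l` writes `Gξ` as an `ℓ_∞` part of size `l` plus an `ℓ₂` part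
weighted by `√t`, and `√t √n ≤ l` because `m ≥ n^{q/2}`. Hence `G : ℓ₂ⁿ → X` has norm `O(t^{-1/q} l)
= O(m^{1/q})`, which the factor `m^{-2/q}` compensates in `G ⊗ G` (`Regular.epsNorm_le`).

Minimal norm: test with the transpose of `G` into a column of `M_n`, scaled by `t^{-1/q}/m` up to a
constant. It is a complete contraction because it is bounded against each of the three summands of
`K(t)`. Applied on both legs it produces the Hilbert–Schmidt norm of `G Gᵀ`, at least of order `m
√n`, and this gives `n^{1/2-2/q}` (`Regular.minNorm_ge`).

All conditions on `G` are strict inequalities, so they define an open set; it meets the full-rank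
matrices in a nonempty open set, which the Gaussian law charges. -/

/-! ### Gaussian moments and rotation invariance -/

theorem lintegral_exp_mul_sq_gaussianReal {b : ℝ} (hb : b < 1 / 2) :
    ∫⁻ x, ENNReal.ofReal (Real.exp (b * x ^ 2)) ∂(gaussianReal 0 1) =
      ENNReal.ofReal (√(1 / (1 - 2 * b))) := by
  have hc : 0 < 1 / 2 - b := by linarith
  rw [gaussianReal_of_var_ne_zero _ one_ne_zero,
    lintegral_withDensity_eq_lintegral_mul _ (measurable_gaussianPDF 0 1) (by fun_prop)]
  have h : ∀ x : ℝ, (gaussianPDF 0 1 * fun x => ENNReal.ofReal (Real.exp (b * x ^ 2))) x =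
      ENNReal.ofReal ((√(2 * Real.pi))⁻¹ * Real.exp (-(1 / 2 - b) * x ^ 2)) := fun x => by
    rw [Pi.mul_apply, gaussianPDF, gaussianPDFReal, ← ENNReal.ofReal_mul (by positivity), mul_assoc,
      ← Real.exp_add]
    congr 2
    · simp
    · congr 1
      simp only [sub_zero, NNReal.coe_one]
      ring
  simp_rw [h]
  rw [← ofReal_integral_eq_lintegral_ofReal
    ((integrable_exp_neg_mul_sq hc).const_mul _) (ae_of_all _ fun x => by positivity),
    integral_const_mul, integral_gaussian, ← Real.sqrt_inv, ← Real.sqrt_mul (by positivity)]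
  congr 2
  have := Real.pi_pos.ne'
  have h2 : (1 - 2 * b) ≠ 0 := by linarith
  have h3 : (1 / 2 - b) ≠ 0 := hc.ne'
  field_simp

theorem lintegral_pi_prod {ι : Type*} [Fintype ι] (μ : Measure ℝ) [IsProbabilityMeasure μ]
    {F : ℝ → ℝ≥0∞} (hF : Measurable F) :
    ∫⁻ x, ∏ i, F (x i) ∂(Measure.pi fun _ : ι => μ) = (∫⁻ x, F x ∂μ) ^ Fintype.card ι := by
  rw [lintegral_prod_eq_prod_lintegral_of_indepFun Finset.univ
    (fun (i : ι) (x : ι → ℝ) => F (x i)) (iIndepFun_pi fun _ => hF.aemeasurable) (fun i => by fun_prop)]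
  rw [← Finset.card_univ, ← Finset.prod_const]
  refine Finset.prod_congr rfl fun i _ => ?_
  exact (measurePreserving_eval (fun _ : ι => μ) i).lintegral_comp hF

/-- Exponential Markov inequality for sums of functions of independent coordinates. -/
theorem measure_le_sum_le {ι : Type*} [Fintype ι] (μ : Measure ℝ) [IsProbabilityMeasure μ]
    {f : ℝ → ℝ} (hf : Measurable f) (s c : ℝ)
    (hc : ∫⁻ x, ENNReal.ofReal (Real.exp (f x)) ∂μ ≤ ENNReal.ofReal c) (hc0 : 0 ≤ c) :
    Measure.pi (fun _ : ι => μ) {x | s ≤ ∑ i, f (x i)} ≤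
      ENNReal.ofReal (c ^ Fintype.card ι * Real.exp (-s)) := by
  have hsub : {x : ι → ℝ | s ≤ ∑ i, f (x i)} ⊆
      {x | ENNReal.ofReal (Real.exp s) ≤ ∏ i, ENNReal.ofReal (Real.exp (f (x i)))} := by
    intro x hx
    rw [Set.mem_ofPred_eq, ← ENNReal.ofReal_prod_of_nonneg (fun i _ => (Real.exp_pos _).le),
      ← Real.exp_sum]
    exact ENNReal.ofReal_le_ofReal (Real.exp_le_exp.2 hx)
  have hM := mul_meas_ge_le_lintegral₀ (μ := Measure.pi (fun _ : ι => μ))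
    (f := fun x => ∏ i, ENNReal.ofReal (Real.exp (f (x i))))
    (Measurable.aemeasurable (by fun_prop)) (ENNReal.ofReal (Real.exp s))
  rw [lintegral_pi_prod μ (F := fun x => ENNReal.ofReal (Real.exp (f x))) (by fun_prop)] at hM
  have hM2 := hM.trans (pow_le_pow_left' hc _)
  refine (measure_mono hsub).trans ?_
  rw [Real.exp_neg, ENNReal.ofReal_mul (by positivity), ENNReal.ofReal_inv_of_pos (Real.exp_pos s),
    ← div_eq_mul_inv, ENNReal.le_div_iff_mul_le
      (Or.inl (by simpa using Real.exp_pos s)) (Or.inl ENNReal.ofReal_ne_top), mul_comm,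
    ENNReal.ofReal_pow hc0]
  exact hM2

/-- A unit vector applied to the rows of a Gaussian matrix produces a standard Gaussian vector. -/
theorem map_gaussianMatrix (n m : ℕ) (ξ : Fin n → ℝ) (hξ : ∑ i, ξ i ^ 2 = 1) :
    (gaussianMatrix n m).map (fun g j => ∑ i, ξ i * g (i, j)) =
      Measure.pi fun _ : Fin m => gaussianReal 0 1 := by
  have hL : Measurable (fun (g : Fin n × Fin m → ℝ) j => ∑ i, ξ i * g (i, j)) := by fun_prop
  have hT : Measurable (WithLp.toLp 2 : (Fin m → ℝ) → EuclideanSpace ℝ (Fin m)) := by fun_prop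
  have hT' : Measurable (WithLp.ofLp : EuclideanSpace ℝ (Fin m) → (Fin m → ℝ)) := by fun_prop
  -- Compare characteristic functions: pairing with `t` amounts to pairing `g` with `ξ ⊗ t`, whose
  -- norm is `‖t‖`.
  have key : ((gaussianMatrix n m).map (fun g j => ∑ i, ξ i * g (i, j))).map (WithLp.toLp 2) =
      (Measure.pi fun _ : Fin m => gaussianReal 0 1).map (WithLp.toLp 2) := by
    rw [map_pi_eq_stdGaussian]
    have : IsFiniteMeasure (gaussianMatrix n m) := by unfold gaussianMatrix; infer_instance
    apply Measure.ext_of_charFun (E := EuclideanSpace ℝ (Fin m))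
    ext t
    rw [charFun_stdGaussian, Measure.map_map hT hL, charFun_apply,
      integral_map (hT.comp hL).aemeasurable (Measurable.aestronglyMeasurable (by fun_prop))]
    have h := charFun_stdGaussian (E := EuclideanSpace ℝ (Fin n × Fin m))
      (WithLp.toLp 2 fun p => ξ p.1 * t p.2)
    rw [← map_pi_eq_stdGaussian, charFun_apply, integral_map (by fun_prop)
      (Measurable.aestronglyMeasurable (by fun_prop))] at h
    have hin : ∀ g : Fin n × Fin m → ℝ,
        inner ℝ ((WithLp.toLp 2 ∘ fun (g : Fin n × Fin m → ℝ) j => ∑ i, ξ i * g (i, j)) g) t =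
        inner ℝ (WithLp.toLp 2 g : EuclideanSpace ℝ (Fin n × Fin m))
          (WithLp.toLp 2 fun p => ξ p.1 * t p.2) := fun g => by
      simp only [Function.comp, PiLp.inner_apply, Fintype.sum_prod_type]
      rw [Finset.sum_comm]
      refine Finset.sum_congr rfl fun j _ => ?_
      simp only [RCLike.inner_apply, conj_trivial, Finset.mul_sum]
      exact Finset.sum_congr rfl fun i _ => by ring
    have hnorm : ‖(WithLp.toLp 2 fun p => ξ p.1 * t p.2 : EuclideanSpace ℝ (Fin n × Fin m))‖ ^ 2 =
        ‖t‖ ^ 2 := by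
      rw [EuclideanSpace.real_norm_sq_eq, EuclideanSpace.real_norm_sq_eq, Fintype.sum_prod_type]
      simp only [mul_pow, ← Finset.mul_sum, ← Finset.sum_mul, hξ, one_mul]
    simp_rw [hin]
    rw [gaussianMatrix, h, ← Complex.ofReal_pow, ← Complex.ofReal_pow, hnorm]
  have h2 := congrArg (Measure.map (WithLp.ofLp : EuclideanSpace ℝ (Fin m) → (Fin m → ℝ))) key
  rw [Measure.map_map hT' hT, Measure.map_map hT' hT] at h2
  simpa [Function.comp_def, Measure.map_id'] using h2

/-! ### Nets of the sphere -/

/-- The unit sphere of `ℝⁿ` has a `1/2`-net with at most `5 ^ n` points. -/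
theorem exists_net (n : ℕ) : ∃ S : Finset (EuclideanSpace ℝ (Fin n)), S.card ≤ 5 ^ n ∧
    (∀ ξ ∈ S, ‖ξ‖ = 1) ∧ ∀ v : EuclideanSpace ℝ (Fin n), ‖v‖ = 1 → ∃ ξ ∈ S, ‖v - ξ‖ ≤ 1 / 2 := by
  classical
  let P : Finset (EuclideanSpace ℝ (Fin n)) → Prop := fun S =>
    (∀ ξ ∈ S, ‖ξ‖ = 1) ∧ ∀ c ∈ S, ∀ d ∈ S, c ≠ d → 1 / 2 ≤ ‖c - d‖
  have hcard : ∀ S, P S → S.card ≤ 5 ^ n := by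
    intro S hS
    have hinj : Function.Injective (fun x : EuclideanSpace ℝ (Fin n) => (2 : ℝ) • x) :=
      smul_right_injective _ two_ne_zero
    -- Doubling gives `1`-separated points in the ball of radius `2`, the setting of the `5 ^ n`
    -- bound.
    have h := Besicovitch.card_le_of_separated (S.image fun x => (2 : ℝ) • x) ?_ ?_
    · rwa [Finset.card_image_of_injective _ hinj, finrank_euclideanSpace_fin] at h
    · intro c hc
      obtain ⟨x, hx, rfl⟩ := Finset.mem_image.1 hc
      rw [norm_smul, hS.1 x hx]; norm_num
    · intro c hc d hd hcd
      obtain ⟨x, hx, rfl⟩ := Finset.mem_image.1 hc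
      obtain ⟨y, hy, rfl⟩ := Finset.mem_image.1 hd
      have := hS.2 x hx y hy (fun h => hcd (by rw [h]))
      rw [← smul_sub, norm_smul, Real.norm_two]; linarith
  let Q : ℕ → Prop := fun k => ∃ S, P S ∧ S.card = k
  have hQ0 : Q 0 := ⟨∅, ⟨by simp, by simp⟩, rfl⟩
  -- A separated set of maximal cardinality is a net: a point far from it could be added.
  obtain ⟨S, hS, hSc⟩ := Nat.findGreatest_spec (P := Q) (Nat.zero_le (5 ^ n)) hQ0
  refine ⟨S, hcard S hS, hS.1, fun v hv => ?_⟩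
  by_contra! hcon
  have hvS : v ∉ S := fun h => by have := hcon v h; simp at this; linarith
  have hP : P (insert v S) := by
    refine ⟨fun ξ hξ => ?_, fun c hc d hd hcd => ?_⟩
    · rcases Finset.mem_insert.1 hξ with rfl | h
      exacts [hv, hS.1 _ h]
    · rcases Finset.mem_insert.1 hc with rfl | h <;> rcases Finset.mem_insert.1 hd with rfl | h'
      · exact absurd rfl hcd
      · exact (hcon d h').le
      · rw [norm_sub_rev]; exact (hcon c h).le
      · exact hS.2 c h d h' hcd
  have h1 := Nat.le_findGreatest (P := Q) (hcard _ hP) ⟨_, hP, rfl⟩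
  rw [Finset.card_insert_of_notMem hvS, ← hSc] at h1
  omega

/-- With `ξ` within `1/2` of `v/‖v‖`, one gets `‖v‖ = ⟨v, v/‖v‖⟩ ≤ M + ‖v‖/2`. -/
theorem norm_le_of_net {n : ℕ} {S : Finset (EuclideanSpace ℝ (Fin n))}
    (hS : ∀ v : EuclideanSpace ℝ (Fin n), ‖v‖ = 1 → ∃ ξ ∈ S, ‖v - ξ‖ ≤ 1 / 2)
    (v : EuclideanSpace ℝ (Fin n)) {M : ℝ} (hM0 : 0 ≤ M)
    (hM : ∀ ξ ∈ S, |∑ i, ξ i * v i| ≤ M) : ‖v‖ ≤ 2 * M := by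
  rcases eq_or_ne v 0 with rfl | hv
  · simpa using hM0
  have hv' : 0 < ‖v‖ := norm_pos_iff.2 hv
  obtain ⟨ξ, hξ, hd⟩ := hS (‖v‖⁻¹ • v) (norm_smul_inv_norm hv)
  have h1 : inner ℝ v (‖v‖⁻¹ • v - ξ) ≤ ‖v‖ * (1 / 2) :=
    (real_inner_le_norm _ _).trans (by gcongr)
  have h2 : inner ℝ v ξ ≤ M := by
    refine (le_abs_self _).trans (le_trans (le_of_eq ?_) (hM ξ hξ))
    simp [PiLp.inner_apply]
  rw [inner_sub_right, real_inner_smul_right, real_inner_self_eq_norm_sq] at h1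
  have h3 : ‖v‖⁻¹ * ‖v‖ ^ 2 = ‖v‖ := by field_simp
  linarith

/-! ### Typical behaviour of Gaussian matrices -/

/-- The amount by which `|x|` exceeds the level `l`. -/
noncomputable def excess (l x : ℝ) : ℝ := max (|x| - l) 0

@[fun_prop]
theorem continuous_excess (l : ℝ) : Continuous (excess l) := by unfold excess; fun_prop

theorem abs_le_add_excess (l x : ℝ) : |x| ≤ l + excess l x := by
  have := le_max_left (|x| - l) 0
  unfold excess; linarith

theorem excess_zero_sq (x : ℝ) : excess 0 x ^ 2 = x ^ 2 := by
  rw [excess, sub_zero, max_eq_left (abs_nonneg x), sq_abs]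

/-- For `|x| ≥ l` one has `(|x| - l)² ≤ x² - l²`, so the integrand is at most `1 + e^{-l²/4}
e^{x²/4}`; the last factor has mean `√2 ≤ 2`. -/
theorem lintegral_exp_excess_sq_le {l : ℝ} (hl : 0 ≤ l) :
    ∫⁻ x, ENNReal.ofReal (Real.exp (excess l x ^ 2 / 4)) ∂(gaussianReal 0 1) ≤
      ENNReal.ofReal (1 + 2 * Real.exp (-(l ^ 2 / 4))) := by
  have hp : ∀ x : ℝ, ENNReal.ofReal (Real.exp (excess l x ^ 2 / 4)) ≤
      1 + ENNReal.ofReal (Real.exp (-(l ^ 2 / 4))) * ENNReal.ofReal (Real.exp (1 / 4 * x ^ 2)) := by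
    intro x
    rw [← ENNReal.ofReal_mul (Real.exp_pos _).le, ← Real.exp_add, ← ENNReal.ofReal_one,
      ← ENNReal.ofReal_add zero_le_one (Real.exp_pos _).le]
    refine ENNReal.ofReal_le_ofReal ?_
    rcases le_total (|x|) l with h | h
    · rw [excess, max_eq_right (by linarith)]
      simpa using (Real.exp_pos _).le
    · rw [excess, max_eq_left (by linarith)]
      refine (Real.exp_le_exp.2 ?_).trans (le_add_of_nonneg_left zero_le_one)
      rw [← sq_abs x]
      nlinarith
  refine (lintegral_mono hp).trans ?_
  rw [lintegral_add_left measurable_const, lintegral_const_mul _ (by fun_prop),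
    lintegral_exp_mul_sq_gaussianReal (by norm_num), lintegral_const, measure_univ, mul_one,
    ← ENNReal.ofReal_mul (Real.exp_pos _).le, ← ENNReal.ofReal_one,
    ← ENNReal.ofReal_add zero_le_one (by positivity)]
  refine ENNReal.ofReal_le_ofReal ?_
  have h2 : √(1 / (1 - 2 * (1 / 4 : ℝ))) ≤ 2 := Real.sqrt_le_iff.2 ⟨by norm_num, by norm_num⟩
  have := mul_le_mul_of_nonneg_left h2 (Real.exp_pos (-(l ^ 2 / 4))).le
  linarith

/-- The linear combination of the rows of `g` with coefficients `ξ`. -/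
def comb {n m : ℕ} (g : Fin n × Fin m → ℝ) (ξ : Fin n → ℝ) (j : Fin m) : ℝ :=
  ∑ i, ξ i * g (i, j)

/-- Exponential Markov for each `ξ`, then a union bound over the net. The case `l = 0` controls the
plain sum of squares. -/
theorem measure_exists_excess_le {n : ℕ} (m : ℕ) {S : Finset (EuclideanSpace ℝ (Fin n))}
    (hcard : S.card ≤ 5 ^ n) (hS : ∀ ξ ∈ S, ‖ξ‖ = 1) {l : ℝ} (hl : 0 ≤ l) (s : ℝ) :
    gaussianMatrix n m {g | ∃ ξ ∈ S, 4 * s ≤ ∑ j, excess l (comb g ξ j) ^ 2} ≤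
      ENNReal.ofReal (5 ^ n * (1 + 2 * Real.exp (-(l ^ 2 / 4))) ^ m * Real.exp (-s)) := by
  set c : ℝ := (1 + 2 * Real.exp (-(l ^ 2 / 4))) ^ m * Real.exp (-s) with hc
  have hc0 : 0 ≤ c := by positivity
  have h1 : ∀ ξ ∈ S, gaussianMatrix n m {g | 4 * s ≤ ∑ j, excess l (comb g ξ j) ^ 2} ≤
      ENNReal.ofReal c := by
    intro ξ hξ
    have hm := map_gaussianMatrix n m ξ (by rw [← EuclideanSpace.real_norm_sq_eq, hS ξ hξ, one_pow])
    have h := measure_le_sum_le (ι := Fin m) (gaussianReal 0 1) (f := fun x => excess l x ^ 2 / 4)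
      (by fun_prop) s _ (lintegral_exp_excess_sq_le hl) (by positivity)
    rw [← hm, Measure.map_apply (by fun_prop)
      (measurableSet_le (by fun_prop) (by fun_prop)), Fintype.card_fin] at h
    refine (measure_mono fun g hg => ?_).trans h
    have hg' : 4 * s ≤ ∑ j, excess l (comb g ξ j) ^ 2 := hg
    change s ≤ ∑ j, excess l (comb g ξ j) ^ 2 / 4
    rw [← Finset.sum_div]
    linarith
  have hset : {g : Fin n × Fin m → ℝ | ∃ ξ ∈ S, 4 * s ≤ ∑ j, excess l (comb g ξ j) ^ 2} =
      ⋃ ξ ∈ S, {g | 4 * s ≤ ∑ j, excess l (comb g ξ j) ^ 2} := by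
    ext g; simp
  rw [hset]
  refine (measure_biUnion_finset_le _ _).trans ((Finset.sum_le_sum h1).trans ?_)
  rw [Finset.sum_const, nsmul_eq_mul, mul_assoc, ← hc, ← ENNReal.ofReal_natCast,
    ← ENNReal.ofReal_mul (by positivity)]
  refine ENNReal.ofReal_le_ofReal (mul_le_mul_of_nonneg_right ?_ hc0)
  exact_mod_cast hcard

/-- Markov for `e^{-50x²}`, whose mean is `1/√101 ≤ 1/10`. The threshold costs `e^{1/100} ≤ 3` per
entry, leaving `(3/10)^{nm}`. -/
theorem measure_sum_sq_le (n m : ℕ) (h : 1 ≤ n * m) :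
    gaussianMatrix n m {g | ∑ p, g p ^ 2 ≤ (n : ℝ) * m / 5000} ≤ ENNReal.ofReal (3 / 10) := by
  have hint : ∫⁻ x, ENNReal.ofReal (Real.exp (-50 * x ^ 2)) ∂(gaussianReal 0 1) ≤
      ENNReal.ofReal (1 / 10) := by
    rw [lintegral_exp_mul_sq_gaussianReal (by norm_num)]
    exact ENNReal.ofReal_le_ofReal (Real.sqrt_le_iff.2 ⟨by norm_num, by norm_num⟩)
  have h1 := measure_le_sum_le (ι := Fin n × Fin m) (gaussianReal 0 1)
    (f := fun x => -50 * x ^ 2) (by fun_prop) (-((n : ℝ) * m / 100)) _ hint (by norm_num)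
  refine (measure_mono fun g hg => ?_).trans (h1.trans (ENNReal.ofReal_le_ofReal ?_))
  · have hg' : ∑ p, g p ^ 2 ≤ (n : ℝ) * m / 5000 := hg
    change -((n : ℝ) * m / 100) ≤ ∑ p, -50 * g p ^ 2
    rw [← Finset.mul_sum]
    linarith
  · rw [Fintype.card_prod, Fintype.card_fin, Fintype.card_fin, neg_neg]
    have he : Real.exp ((n : ℝ) * m / 100) = Real.exp (1 / 100) ^ (n * m) := by
      rw [← Real.exp_nat_mul]; push_cast; ring_nf
    rw [he, ← mul_pow]
    have h2 : Real.exp (1 / 100) ≤ 3 :=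
      (Real.exp_le_exp.2 (by norm_num)).trans (Real.exp_one_lt_d9.le.trans (by norm_num))
    calc _ ≤ (3 / 10 : ℝ) ^ (n * m) := by
          refine pow_le_pow_left₀ (by positivity) ?_ _
          linarith
      _ ≤ (3 / 10 : ℝ) ^ 1 := pow_le_pow_of_le_one (by norm_num) (by norm_num) h
      _ = 3 / 10 := pow_one _

/-- A deterministic regularity condition on a matrix, satisfied by typical Gaussian matrices. -/
structure Regular {n m : ℕ} (S : Finset (EuclideanSpace ℝ (Fin n))) (l B : ℝ)
    (g : Fin n × Fin m → ℝ) : Prop where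
  excess_lt : ∀ ξ ∈ S, ∑ j, excess l (comb g ξ j) ^ 2 < 4 * (B * n)
  comb_lt : ∀ ξ ∈ S, ∑ j, comb g ξ j ^ 2 < 4 * (6 * m)
  lt_sum : (n : ℝ) * m / 5000 < ∑ p, g p ^ 2

theorem isOpen_regular {n : ℕ} (m : ℕ) (S : Finset (EuclideanSpace ℝ (Fin n))) (l B : ℝ) :
    IsOpen {g : Fin n × Fin m → ℝ | Regular S l B g} := by
  have h : {g : Fin n × Fin m → ℝ | Regular S l B g} =
      (⋂ ξ ∈ S, {g | ∑ j, excess l (comb g ξ j) ^ 2 < 4 * (B * n)}) ∩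
      ((⋂ ξ ∈ S, {g | ∑ j, comb g ξ j ^ 2 < 4 * (6 * m)}) ∩
      {g | (n : ℝ) * m / 5000 < ∑ p, g p ^ 2}) := by
    ext g
    simp only [Set.mem_ofPred_eq, Set.mem_inter_iff, Set.mem_iInter]
    exact ⟨fun h => ⟨h.1, h.2, h.3⟩, fun h => ⟨h.1, h.2.1, h.2.2⟩⟩
  rw [h]
  unfold comb
  refine (isOpen_biInter_finset fun ξ _ => ?_).inter
    ((isOpen_biInter_finset fun ξ _ => ?_).inter ?_)
  · exact isOpen_lt (by fun_prop) (by fun_prop)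
  · exact isOpen_lt (by fun_prop) (by fun_prop)
  · exact isOpen_lt (by fun_prop) (by fun_prop)

/-- The three failure probabilities are at most `1/4`, `1/4` and `3/10`, with sum below `1`. In the
rate `(2K + 4) n`, the net costs `2n` (as `5 ≤ e²`) and the moment factor `2K`; a gain of at least
`e^{-2}` remains. -/
theorem exists_regular {n m : ℕ} (hn : 1 ≤ n) (hnm : n ≤ m)
    {S : Finset (EuclideanSpace ℝ (Fin n))} (hcard : S.card ≤ 5 ^ n) (hS : ∀ ξ ∈ S, ‖ξ‖ = 1)
    {l K : ℝ} (hl : 0 ≤ l) (hK : 0 ≤ K) (hmK : m * Real.exp (-(l ^ 2 / 4)) ≤ K) :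
    ∃ g : Fin n × Fin m → ℝ, Regular S l (2 * K + 4) g := by
  have hn' : (1 : ℝ) ≤ n := by exact_mod_cast hn
  have hnm' : (n : ℝ) ≤ m := by exact_mod_cast hnm
  have he1 : (2 : ℝ) ≤ Real.exp 1 := by have := Real.add_one_le_exp (1 : ℝ); linarith
  have he2 : Real.exp 2 = Real.exp 1 * Real.exp 1 := by rw [← Real.exp_add]; norm_num
  have h5 : (5 : ℝ) ≤ Real.exp 2 := by have := Real.exp_one_gt_d9; nlinarith
  have h5n : ∀ k : ℕ, (5 : ℝ) ^ k ≤ Real.exp (2 * k) := fun k => by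
    rw [mul_comm, Real.exp_nat_mul]; exact pow_le_pow_left₀ (by norm_num) h5 k
  have hsmall : Real.exp (-2) ≤ 1 / 4 := by
    rw [Real.exp_neg, one_div]
    exact inv_anti₀ (by norm_num) (by linarith)
  have hA := measure_exists_excess_le m hcard hS hl ((2 * K + 4) * n)
  have hB := measure_exists_excess_le m hcard hS le_rfl (6 * m)
  have hC := measure_sum_sq_le n m (Nat.mul_pos hn (hn.trans hnm))
  have hA' : (5 : ℝ) ^ n * (1 + 2 * Real.exp (-(l ^ 2 / 4))) ^ m * Real.exp (-((2 * K + 4) * n)) ≤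
      1 / 4 := by
    have h1 : (1 + 2 * Real.exp (-(l ^ 2 / 4))) ^ m ≤ Real.exp (2 * K) := by
      calc _ ≤ Real.exp (2 * Real.exp (-(l ^ 2 / 4))) ^ m := by
            refine pow_le_pow_left₀ (by positivity) ?_ _
            have := Real.add_one_le_exp (2 * Real.exp (-(l ^ 2 / 4))); linarith
        _ = Real.exp (m * (2 * Real.exp (-(l ^ 2 / 4)))) := (Real.exp_nat_mul _ _).symm
        _ ≤ _ := Real.exp_le_exp.2 (by linarith)
    calc _ ≤ Real.exp (2 * n) * Real.exp (2 * K) * Real.exp (-((2 * K + 4) * n)) := by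
          gcongr
          exact h5n n
      _ = Real.exp (2 * n + 2 * K - (2 * K + 4) * n) := by
          rw [← Real.exp_add, ← Real.exp_add]; ring_nf
      _ ≤ Real.exp (-2) := Real.exp_le_exp.2 (by nlinarith)
      _ ≤ _ := hsmall
  have hB' : (5 : ℝ) ^ n * (1 + 2 * Real.exp (-((0 : ℝ) ^ 2 / 4))) ^ m * Real.exp (-(6 * m)) ≤
      1 / 4 := by
    calc _ ≤ Real.exp (2 * n) * Real.exp (2 * m) * Real.exp (-(6 * m)) := by
          gcongr
          · exact h5n n
          · refine le_trans (pow_le_pow_left₀ (by positivity) ?_ _) (h5n m)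
            norm_num
      _ = Real.exp (2 * n + 2 * m - 6 * m) := by
          rw [← Real.exp_add, ← Real.exp_add]; ring_nf
      _ ≤ Real.exp (-2) := Real.exp_le_exp.2 (by linarith)
      _ ≤ _ := hsmall
  by_contra! hcon
  have hprob : IsProbabilityMeasure (gaussianMatrix n m) := by
    unfold gaussianMatrix; infer_instance
  have hcover : (Set.univ : Set (Fin n × Fin m → ℝ)) ⊆
      {g | ∃ ξ ∈ S, 4 * ((2 * K + 4) * n) ≤ ∑ j, excess l (comb g ξ j) ^ 2} ∪
      ({g | ∃ ξ ∈ S, 4 * (6 * (m : ℝ)) ≤ ∑ j, excess 0 (comb g ξ j) ^ 2} ∪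
      {g | ∑ p, g p ^ 2 ≤ (n : ℝ) * m / 5000}) := by
    intro g _
    by_contra hg
    simp only [Set.mem_union, Set.mem_ofPred_eq, not_or, not_exists, not_and, not_le,
      excess_zero_sq] at hg
    exact hcon g ⟨hg.1, hg.2.1, hg.2.2⟩
  have h1 := measure_mono (μ := gaussianMatrix n m) hcover
  rw [measure_univ] at h1
  have h2 : (1 : ℝ≥0∞) ≤ ENNReal.ofReal (1 / 4 + (1 / 4 + 3 / 10)) := by
    rw [ENNReal.ofReal_add (by norm_num) (by norm_num), ENNReal.ofReal_add (by norm_num)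
      (by norm_num)]
    refine h1.trans ((measure_union_le _ _).trans (add_le_add ?_ ?_))
    · exact hA.trans (ENNReal.ofReal_le_ofReal hA')
    · refine (measure_union_le _ _).trans (add_le_add ?_ hC)
      exact hB.trans (ENNReal.ofReal_le_ofReal hB')
  rw [← ENNReal.ofReal_one, ENNReal.ofReal_le_ofReal_iff (by norm_num)] at h2
  norm_num at h2

/-- With `y = n^{2/q}`, `n^{q/2}` is the power `y^{q²/4}`, beaten by `e^{y/4}`: raise `y/q² ≤
e^{y/q²}` to the power `q²/4`. -/
theorem rpow_mul_exp_le {q : ℝ} (hq : 2 < q) {n : ℕ} {m : ℝ} (hn : 1 ≤ n)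
    (hm : m ≤ 2 * (n : ℝ) ^ (q / 2)) :
    m * Real.exp (-(((n : ℝ) ^ (1 / q)) ^ 2 / 4)) ≤ 2 * (q ^ 2) ^ (q ^ 2 / 4) := by
  have hn' : (0 : ℝ) < n := by exact_mod_cast hn
  set y : ℝ := ((n : ℝ) ^ (1 / q)) ^ 2 with hy
  have hy0 : 0 < y := by positivity
  have hyn : y ^ (q ^ 2 / 4) = (n : ℝ) ^ (q / 2) := by
    rw [hy, ← Real.rpow_natCast, ← Real.rpow_mul hn'.le, ← Real.rpow_mul hn'.le]
    congr 1
    have : q ≠ 0 := by linarith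
    push_cast
    field_simp
    norm_num
  have h1 : y ^ (q ^ 2 / 4) ≤ (q ^ 2) ^ (q ^ 2 / 4) * Real.exp (y / 4) := by
    have h2 : y / q ^ 2 ≤ Real.exp (y / q ^ 2) := by
      have := Real.add_one_le_exp (y / q ^ 2); linarith
    have h3 := Real.rpow_le_rpow (by positivity) h2 (by positivity : 0 ≤ q ^ 2 / 4)
    rw [← Real.exp_mul, Real.div_rpow hy0.le (by positivity), div_le_iff₀ (by positivity)] at h3
    have h4 : y / q ^ 2 * (q ^ 2 / 4) = y / 4 := by
      have : q ≠ 0 := by linarith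
      field_simp
    rw [h4] at h3
    linarith
  rw [Real.exp_neg, ← div_eq_mul_inv, div_le_iff₀ (Real.exp_pos _)]
  rw [← hyn] at hm
  linarith

/-! ### Full rank and positive probability -/

/-- An open property that holds for some matrix holds for some matrix with independent rows. -/
theorem exists_rank_eq_of_isOpen {n m : ℕ} (hnm : n ≤ m) {E : Set (Fin n × Fin m → ℝ)}
    (hE : IsOpen E) (hne : E.Nonempty) :
    ∃ g ∈ E, ((Matrix.of fun i j => g (i, j) : Matrix (Fin n) (Fin m) ℝ).submatrix id
      (Fin.castLE hnm)).det ≠ 0 := by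
  obtain ⟨g₀, hg₀⟩ := hne
  set A : Matrix (Fin n) (Fin n) ℝ :=
    (Matrix.of fun i j => g₀ (i, j) : Matrix (Fin n) (Fin m) ℝ).submatrix id (Fin.castLE hnm)
  -- Along this line the minor is, up to sign, the characteristic polynomial of `A` at `ε`, which
  -- has finitely many roots.
  let γ : ℝ → Fin n × Fin m → ℝ := fun ε p =>
    g₀ p - ε * (if Fin.castLE hnm p.1 = p.2 then 1 else 0)
  have hγ : Continuous γ := by fun_prop
  have hnhds : γ ⁻¹' E ∈ nhds (0 : ℝ) := by
    refine (hE.preimage hγ).mem_nhds ?_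
    simpa [γ] using hg₀
  have hinf : (γ ⁻¹' E).Infinite := infinite_of_mem_nhds 0 hnhds
  have hfin : {x : ℝ | A.charpoly.IsRoot x}.Finite :=
    Polynomial.finite_setOfPred_isRoot A.charpoly_monic.ne_zero
  obtain ⟨ε, hε, hroot⟩ := hinf.exists_notMem_finite hfin
  refine ⟨γ ε, hε, fun hdet => hroot ?_⟩
  change A.charpoly.eval ε = 0
  rw [Matrix.eval_charpoly]
  have hneg : (Matrix.scalar (Fin n) ε - A) = -((Matrix.of fun i j => γ ε (i, j) :
      Matrix (Fin n) (Fin m) ℝ).submatrix id (Fin.castLE hnm)) := by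
    ext i j
    by_cases hij : i = j <;> simp [γ, A, hij, Matrix.scalar_apply]
  rw [hneg, Matrix.det_neg, hdet, mul_zero]

instance : (gaussianReal 0 1).IsOpenPosMeasure :=
  (gaussianReal_absolutelyContinuous' 0 one_ne_zero).isOpenPosMeasure

instance (n m : ℕ) : (gaussianMatrix n m).IsOpenPosMeasure := by
  unfold gaussianMatrix; infer_instance

theorem measure_regular_and_rank_pos {n m : ℕ} (hnm : n ≤ m)
    {S : Finset (EuclideanSpace ℝ (Fin n))} {l B : ℝ}
    (h : ∃ g : Fin n × Fin m → ℝ, Regular S l B g) :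
    0 < gaussianMatrix n m {g | Regular S l B g ∧
      ((Matrix.of fun i j => g (i, j) : Matrix (Fin n) (Fin m) ℝ).submatrix id
        (Fin.castLE hnm)).det ≠ 0} := by
  refine IsOpen.measure_pos _ ?_ ?_
  · refine (isOpen_regular m S l B).inter (isOpen_ne_fun ?_ continuous_const)
    refine Continuous.matrix_det (continuous_matrix fun i j => ?_)
    exact continuous_apply _
  · obtain ⟨g, h1, h2⟩ := exists_rank_eq_of_isOpen hnm (isOpen_regular m S l B) h
    exact ⟨g, h1, h2⟩

/-- The image of the identity has full rank as soon as the first `n` columns are independent. -/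
theorem rank_smul_imageOfIdentity {n m : ℕ} (hnm : n ≤ m) {c : ℂ} (hc : c ≠ 0)
    {g : Fin n × Fin m → ℝ}
    (hg : ((Matrix.of fun i j => g (i, j) : Matrix (Fin n) (Fin m) ℝ).submatrix id
        (Fin.castLE hnm)).det ≠ 0) : (c • imageOfIdentity g).rank = n := by
  set G : Matrix (Fin n) (Fin m) ℂ := Matrix.of fun i j => (g (i, j) : ℂ) with hG
  have h1 : imageOfIdentity g = Gᴴ * G := by
    ext j k
    simp [imageOfIdentity, hG, Matrix.mul_apply]
  have h2 : (c • imageOfIdentity g).rank = G.rank := by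
    rw [h1, ← Matrix.rank_conjTranspose_mul_self G]
    exact Matrix.rank_smul_of_mem_nonZeroDivisors _ (mem_nonZeroDivisors_of_ne_zero hc)
  have h3 : (G.submatrix id (Fin.castLE hnm)).rank = n := by
    have hu : IsUnit (G.submatrix id (Fin.castLE hnm)) := by
      rw [Matrix.isUnit_iff_isUnit_det, isUnit_iff_ne_zero]
      have h4 : G.submatrix id (Fin.castLE hnm) = ((Matrix.of fun i j => g (i, j) :
          Matrix (Fin n) (Fin m) ℝ).submatrix id (Fin.castLE hnm)).map Complex.ofRealHom := by
        ext i j; simp [hG]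
      rw [h4, ← RingHom.mapMatrix_apply, ← RingHom.map_det]
      simpa using hg
    simpa using Matrix.rank_of_isUnit _ hu
  rw [h2]
  refine le_antisymm (by simpa using G.rank_le_card_height) ?_
  conv_lhs => rw [← h3]
  exact Matrix.rank_submatrix_le _ _ _

/-! ### Operator norms of Kronecker products -/

section Norms

variable {ι κ : Type*} [Fintype ι] [DecidableEq ι] [Fintype κ] [DecidableEq κ]

theorem opNorm_eq_norm (A : Matrix ι ι ℂ) : opNorm A = ‖A‖ :=
  Matrix.l2_opNorm_toEuclideanCLM A

/-- A `*`-homomorphism of C*-algebras is contractive. -/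
theorem norm_kronecker_one_le (A : Matrix ι ι ℂ) : ‖A ⊗ₖ (1 : Matrix κ κ ℂ)‖ ≤ ‖A‖ := by
  let f : Matrix ι ι ℂ →⋆ₙₐ[ℂ] Matrix (ι × κ) (ι × κ) ℂ :=
    { toFun := fun A => A ⊗ₖ (1 : Matrix κ κ ℂ)
      map_smul' := fun c A => by simp [Matrix.smul_kronecker]
      map_zero' := by simp
      map_add' := fun A B => Matrix.add_kronecker A B 1
      map_mul' := fun A B => by rw [← Matrix.mul_kronecker_mul, mul_one]
      map_star' := fun A => by simp [Matrix.star_eq_conjTranspose, Matrix.conjTranspose_kronecker] }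
  exact NonUnitalStarAlgHom.norm_apply_le f A

theorem norm_one_kronecker_le (B : Matrix κ κ ℂ) : ‖(1 : Matrix ι ι ℂ) ⊗ₖ B‖ ≤ ‖B‖ := by
  let f : Matrix κ κ ℂ →⋆ₙₐ[ℂ] Matrix (ι × κ) (ι × κ) ℂ :=
    { toFun := fun B => (1 : Matrix ι ι ℂ) ⊗ₖ B
      map_smul' := fun c A => by simp [Matrix.kronecker_smul]
      map_zero' := by simp
      map_add' := fun A B => Matrix.kronecker_add 1 A B
      map_mul' := fun A B => by rw [← Matrix.mul_kronecker_mul, mul_one]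
      map_star' := fun A => by simp [Matrix.star_eq_conjTranspose, Matrix.conjTranspose_kronecker] }
  exact NonUnitalStarAlgHom.norm_apply_le f B

theorem norm_submatrix_equiv_le (e : κ ≃ ι) (A : Matrix ι ι ℂ) : ‖A.submatrix e e‖ ≤ ‖A‖ := by
  let f : Matrix ι ι ℂ →⋆ₙₐ[ℂ] Matrix κ κ ℂ :=
    { toFun := fun A => A.submatrix e e
      map_smul' := fun c A => rfl
      map_zero' := rfl
      map_add' := fun A B => rfl
      map_mul' := fun A B => (Matrix.submatrix_mul_equiv A B e e e).symm
      map_star' := fun A => rfl }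
  exact NonUnitalStarAlgHom.norm_apply_le f A

theorem kronecker_eq_mul (A : Matrix ι ι ℂ) (B : Matrix κ κ ℂ) :
    A ⊗ₖ B = (A ⊗ₖ (1 : Matrix κ κ ℂ)) * ((1 : Matrix ι ι ℂ) ⊗ₖ B) := by
  rw [← Matrix.mul_kronecker_mul, mul_one, one_mul]

theorem norm_kronecker_le (A : Matrix ι ι ℂ) (B : Matrix κ κ ℂ) : ‖A ⊗ₖ B‖ ≤ ‖A‖ * ‖B‖ := by
  rw [kronecker_eq_mul]
  exact (norm_mul_le _ _).trans
    (mul_le_mul (norm_kronecker_one_le A) (norm_one_kronecker_le B) (norm_nonneg _) (norm_nonneg _))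

/-- The Cauchy–Schwarz inequality for sums of products of matrices. -/
theorem norm_sum_mul_le {m : ℕ} (P Q : Fin m → Matrix ι ι ℂ) :
    ‖∑ j, P j * Q j‖ ≤ √‖∑ j, P j * (P j)ᴴ‖ * √‖∑ j, (Q j)ᴴ * Q j‖ := by
  -- The sum is a block row times a block column; the C*-identity computes both norms.
  let R : Matrix ι (Fin m × ι) ℂ := Matrix.of fun a p => P p.1 a p.2
  let C : Matrix (Fin m × ι) ι ℂ := Matrix.of fun p b => Q p.1 p.2 b
  have h1 : ∑ j, P j * Q j = R * C := by
    ext a b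
    simp [R, C, Matrix.sum_apply, Matrix.mul_apply, Fintype.sum_prod_type]
  have h2 : ∑ j, P j * (P j)ᴴ = R * Rᴴ := by
    ext a b
    simp [R, Matrix.sum_apply, Matrix.mul_apply, Fintype.sum_prod_type]
  have h3 : ∑ j, (Q j)ᴴ * Q j = Cᴴ * C := by
    ext a b
    simp [C, Matrix.sum_apply, Matrix.mul_apply, Fintype.sum_prod_type]
  have h4 : ‖R * Rᴴ‖ = ‖R‖ * ‖R‖ := by
    have := Matrix.l2_opNorm_conjTranspose_mul_self Rᴴ
    rwa [Matrix.conjTranspose_conjTranspose, Matrix.l2_opNorm_conjTranspose] at this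
  rw [h1, h2, h3, h4, Matrix.l2_opNorm_conjTranspose_mul_self, Real.sqrt_mul_self (norm_nonneg _),
    Real.sqrt_mul_self (norm_nonneg _)]
  exact Matrix.l2_opNorm_mul R C

theorem norm_sum_kronecker_le_row {m : ℕ} (A : Fin m → Matrix ι ι ℂ) (B : Fin m → Matrix κ κ ℂ) :
    ‖∑ j, A j ⊗ₖ B j‖ ≤ √‖∑ j, A j * (A j)ᴴ‖ * √‖∑ j, (B j)ᴴ * B j‖ := by
  simp_rw [kronecker_eq_mul (A _) (B _)]
  refine (norm_sum_mul_le _ _).trans ?_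
  simp_rw [Matrix.conjTranspose_kronecker, Matrix.conjTranspose_one, ← Matrix.mul_kronecker_mul,
    mul_one]
  gcongr
  · have : ∑ j, (A j * (A j)ᴴ) ⊗ₖ (1 : Matrix κ κ ℂ) = (∑ j, A j * (A j)ᴴ) ⊗ₖ 1 := by
      ext a b; simp [Matrix.sum_apply, Finset.sum_mul]
    rw [this]
    exact norm_kronecker_one_le _
  · have : ∑ j, (1 : Matrix ι ι ℂ) ⊗ₖ ((B j)ᴴ * B j) = 1 ⊗ₖ (∑ j, (B j)ᴴ * B j) := by
      ext a b; simp [Matrix.sum_apply, Finset.mul_sum]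
    rw [this]
    exact norm_one_kronecker_le _

theorem norm_sum_kronecker_swap_le {m : ℕ} (A : Fin m → Matrix ι ι ℂ)
    (B : Fin m → Matrix κ κ ℂ) : ‖∑ j, A j ⊗ₖ B j‖ ≤ ‖∑ j, B j ⊗ₖ A j‖ := by
  have h : ∑ j, A j ⊗ₖ B j =
      (∑ j, B j ⊗ₖ A j).submatrix (Equiv.prodComm ι κ) (Equiv.prodComm ι κ) := by
    ext a b
    simp [Matrix.sum_apply, mul_comm]
  rw [h]
  exact norm_submatrix_equiv_le _ _

theorem norm_sum_kronecker_le_col {m : ℕ} (A : Fin m → Matrix ι ι ℂ) (B : Fin m → Matrix κ κ ℂ) :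
    ‖∑ j, A j ⊗ₖ B j‖ ≤ √‖∑ j, (A j)ᴴ * A j‖ * √‖∑ j, B j * (B j)ᴴ‖ := by
  rw [mul_comm]
  exact (norm_sum_kronecker_swap_le A B).trans (norm_sum_kronecker_le_row B A)

end Norms

/-! ### The matrix norms of `K(t)` and complete contractions -/

section Spaces

variable {m k l : ℕ}

theorem opNorm_nonneg {ι : Type*} [Fintype ι] [DecidableEq ι] (A : Matrix ι ι ℂ) : 0 ≤ opNorm A :=
  norm_nonneg _

theorem norm_le_linfty (x : MatTuple m k) (j : Fin m) : ‖x j‖ ≤ linfty m k x := by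
  rw [← opNorm_eq_norm]
  exact le_ciSup (f := fun j => opNorm (x j)) (Set.finite_range _).bddAbove j

theorem linfty_nonneg (x : MatTuple m k) : 0 ≤ linfty m k x :=
  Real.iSup_nonneg fun _ => opNorm_nonneg _

theorem row_nonneg (x : MatTuple m k) : 0 ≤ row m k x := Real.sqrt_nonneg _

theorem col_nonneg (x : MatTuple m k) : 0 ≤ col m k x := Real.sqrt_nonneg _

theorem rowAddCol_nonneg (x : MatTuple m k) : 0 ≤ rowAddCol m k x :=
  Real.sInf_nonneg fun _ ⟨y, z, _, hr⟩ => hr ▸ add_nonneg (row_nonneg y) (col_nonneg z)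

theorem lone_nonneg (x : MatTuple m k) : 0 ≤ lone m k x :=
  Real.sSup_nonneg fun _ ⟨_, _, _, hr⟩ => hr ▸ opNorm_nonneg _

theorem rowAddCol_le_row (x : MatTuple m k) : rowAddCol m k x ≤ row m k x := by
  refine csInf_le ⟨0, fun r ⟨y, z, _, hr⟩ => hr ▸ add_nonneg (row_nonneg y) (col_nonneg z)⟩
    ⟨x, 0, add_zero x, ?_⟩
  simp [col, opNorm]

theorem lone_zero : lone m k 0 = 0 := by
  refine le_antisymm (Real.sSup_le ?_ le_rfl) (lone_nonneg 0)
  rintro r ⟨l, y, _, rfl⟩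
  simp [amplify, opNorm]

theorem kSpace_le {t : ℝ} (ht : 0 ≤ t) (x₁ x₂ : MatTuple m k) :
    kSpace t m k (x₁ + x₂) ≤ linfty m k x₁ + √t * row m k x₂ := by
  have hle : kSpace t m k (x₁ + x₂) ≤
      linfty m k x₁ + √t * rowAddCol m k x₂ + t * lone m k 0 := by
    refine csInf_le ?_ ⟨x₁, x₂, 0, by simp, rfl⟩
    refine ⟨0, fun r ⟨x₁, x₂, x₃, _, hr⟩ => hr ▸ ?_⟩
    have := linfty_nonneg x₁
    have := rowAddCol_nonneg x₂
    have := lone_nonneg x₃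
    positivity
  rw [lone_zero, mul_zero, add_zero] at hle
  refine hle.trans ?_
  gcongr
  exact rowAddCol_le_row x₂

theorem norm_amplify_le_lone (x : MatTuple m k) (y : MatTuple m l) (hy : ∀ j, ‖y j‖ ≤ 1) :
    ‖amplify y x‖ ≤ lone m k x := by
  refine (norm_sum_kronecker_swap_le x y).trans ?_
  rw [← opNorm_eq_norm]
  -- The upper bound `∑ ‖x j‖` is essential: a real `sSup` of an unbounded set is `0`.
  refine le_csSup ⟨∑ j, ‖x j‖, ?_⟩ ⟨l, y, ?_, rfl⟩
  · rintro r ⟨l, y, hy, rfl⟩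
    rw [opNorm_eq_norm]
    refine (norm_sum_le _ _).trans (Finset.sum_le_sum fun j _ => ?_)
    refine (norm_kronecker_le _ _).trans ?_
    have := (norm_le_linfty y j).trans hy
    exact mul_le_of_le_one_left (norm_nonneg _) this
  · exact Real.iSup_le (fun j => by rw [opNorm_eq_norm]; exact hy j) zero_le_one

theorem amplify_add (U : MatTuple m l) (x y : MatTuple m k) :
    amplify U (x + y) = amplify U x + amplify U y := by
  simp [amplify, Matrix.add_kronecker, Finset.sum_add_distrib]

/-- A criterion for complete contractivity on `X_t^q`, by duality with each of the summands. -/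
theorem isCompleteContraction_xSpace {q t : ℝ} (ht : 0 < t) (hm : 0 < m) (htm : 1 ≤ t * m)
    (U : MatTuple m l) (hcol : ‖∑ j, (U j)ᴴ * U j‖ ≤ (t ^ (-1 / q)) ^ 2 * t)
    (hrow : ‖∑ j, U j * (U j)ᴴ‖ ≤ (t ^ (-1 / q)) ^ 2 / m)
    (hmax : ∀ j, ‖U j‖ ≤ t ^ (-1 / q) * t) : IsCompleteContraction (xSpace q t m) U := by
  set a : ℝ := t ^ (-1 / q) with ha
  have ha0 : 0 < a := Real.rpow_pos_of_pos ht _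
  have hm' : (0 : ℝ) < m := by exact_mod_cast hm
  have hsc : √‖∑ j, (U j)ᴴ * U j‖ ≤ a * √t := by
    refine (Real.sqrt_le_sqrt hcol).trans (le_of_eq ?_)
    rw [Real.sqrt_mul (by positivity), Real.sqrt_sq ha0.le]
  have hsr : √‖∑ j, U j * (U j)ᴴ‖ ≤ a / √m := by
    refine (Real.sqrt_le_sqrt hrow).trans (le_of_eq ?_)
    rw [Real.sqrt_div (by positivity), Real.sqrt_sq ha0.le]
  -- Since `1 ≤ t m`, the row bound needed against `ℓ_∞` also serves against `C^m`.
  have hsr' : √‖∑ j, U j * (U j)ᴴ‖ ≤ a * √t := by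
    refine hsr.trans ?_
    rw [div_le_iff₀ (by positivity), mul_assoc, ← Real.sqrt_mul ht.le]
    exact le_mul_of_one_le_right ha0.le (Real.one_le_sqrt.2 htm)
  intro k x
  -- The column norm of `x` is at most `√m` times its maximum, and this `√m` cancels the one in the
  -- row bound of `U`.
  have hinf : ∀ x : MatTuple m k, ‖amplify U x‖ ≤ a * linfty m k x := fun x => by
    have h1 : √‖∑ j, (x j)ᴴ * x j‖ ≤ √m * linfty m k x := by
      refine Real.sqrt_le_iff.2 ⟨mul_nonneg (Real.sqrt_nonneg _) (linfty_nonneg x), ?_⟩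
      rw [mul_pow, Real.sq_sqrt hm'.le]
      refine (norm_sum_le _ _).trans ((Finset.sum_le_sum (g := fun _ => linfty m k x ^ 2)
        fun j _ => ?_).trans ?_)
      · rw [Matrix.l2_opNorm_conjTranspose_mul_self, ← sq]
        exact pow_le_pow_left₀ (norm_nonneg _) (norm_le_linfty x j) 2
      · simp
    refine (norm_sum_kronecker_le_col x U).trans ((mul_le_mul h1 hsr (Real.sqrt_nonneg _)
      (mul_nonneg (Real.sqrt_nonneg _) (linfty_nonneg x))).trans (le_of_eq ?_))
    field_simp
  have hrc : ∀ x : MatTuple m k, ‖amplify U x‖ ≤ a * √t * rowAddCol m k x := fun x => by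
    rw [← div_le_iff₀' (by positivity)]
    refine le_csInf ⟨_, x, 0, add_zero x, rfl⟩ ?_
    rintro r ⟨y, z, rfl, rfl⟩
    rw [div_le_iff₀' (by positivity), amplify_add, mul_add]
    refine (norm_add_le _ _).trans (add_le_add ?_ ?_)
    · rw [row, opNorm_eq_norm, mul_comm]
      exact (norm_sum_kronecker_le_row y U).trans (by gcongr)
    · rw [col, opNorm_eq_norm, mul_comm]
      exact (norm_sum_kronecker_le_col z U).trans (by gcongr)
  have hone : ∀ x : MatTuple m k, ‖amplify U x‖ ≤ a * t * lone m k x := fun x => by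
    have hat : 0 < a * t := by positivity
    have h1 := norm_amplify_le_lone x (fun j => ((a * t : ℝ) : ℂ)⁻¹ • U j) (fun j => by
      rw [norm_smul, norm_inv, Complex.norm_real, Real.norm_of_nonneg hat.le,
        inv_mul_le_iff₀ hat, mul_one]
      exact hmax j)
    have h2 : amplify (fun j => ((a * t : ℝ) : ℂ)⁻¹ • U j) x =
        ((a * t : ℝ) : ℂ)⁻¹ • amplify U x := by
      simp [amplify, Matrix.kronecker_smul, Finset.smul_sum]
    rwa [h2, norm_smul, norm_inv, Complex.norm_real, Real.norm_of_nonneg hat.le,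
      inv_mul_le_iff₀ hat] at h1
  rw [opNorm_eq_norm, xSpace, ← ha, ← div_le_iff₀' ha0]
  refine le_csInf ⟨_, x, 0, 0, by simp, rfl⟩ ?_
  rintro r ⟨x₁, x₂, x₃, rfl, rfl⟩
  rw [div_le_iff₀' ha0, amplify_add, amplify_add]
  have h1 := hinf x₁
  have h2 := hrc x₂
  have h3 := hone x₃
  refine (norm_add₃_le).trans ?_
  linarith

theorem norm_of_const (c : ℂ) : ‖(Matrix.of fun _ _ => c : Matrix (Fin 1) (Fin 1) ℂ)‖ = ‖c‖ := by
  have : (Matrix.of fun _ _ => c : Matrix (Fin 1) (Fin 1) ℂ) = Matrix.diagonal fun _ => c := by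
    ext i j
    simp [Subsingleton.elim i j]
  rw [this, Matrix.l2_opNorm_diagonal, pi_norm_const]

/-- Clip each entry to `[-l, l]`: the clipped part is measured in `ℓ_∞`, the remainder in `R^m`, and
nothing in `ℓ_1`. -/
theorem baseNorm_kSpace_le {t : ℝ} (ht : 0 ≤ t) {l : ℝ} (hl : 0 ≤ l) (h : Fin m → ℝ) :
    baseNorm (kSpace t m) (fun j => (h j : ℂ)) ≤ l + √t * √(∑ j, excess l (h j) ^ 2) := by
  let h₂ : Fin m → ℝ := fun j => SignType.sign (h j) * excess l (h j)
  let h₁ : Fin m → ℝ := fun j => h j - h₂ j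
  have hsplit : (fun j => Matrix.of fun _ _ => (h j : ℂ) : MatTuple m 1) =
      (fun j => Matrix.of fun _ _ => (h₁ j : ℂ)) + (fun j => Matrix.of fun _ _ => (h₂ j : ℂ)) := by
    funext j
    ext
    simp [h₁]
  have hh₁ : ∀ j, |h₁ j| ≤ l := fun j => by
    have e := sign_mul_abs (h j)
    have : h₁ j = SignType.sign (h j) * (|h j| - excess l (h j)) := by
      simp only [h₁, h₂]; rw [mul_sub, e]
    rw [this, abs_mul]
    have hs : |((SignType.sign (h j) : SignType) : ℝ)| ≤ 1 := by
      rcases lt_trichotomy (h j) 0 with h0 | h0 | h0 <;> simp [h0]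
    have hb : |(|h j| - excess l (h j))| ≤ l := by
      rw [abs_le, excess]
      rcases le_total (|h j| - l) 0 with h0 | h0
      · rw [max_eq_right h0]
        have := abs_nonneg (h j)
        constructor <;> linarith
      · rw [max_eq_left h0]
        constructor <;> linarith
    calc _ ≤ 1 * l := mul_le_mul hs hb (abs_nonneg _) zero_le_one
      _ = l := one_mul l
  have hh₂ : ∀ j, h₂ j ^ 2 ≤ excess l (h j) ^ 2 := fun j => by
    rcases lt_trichotomy (h j) 0 with h0 | h0 | h0 <;> simp [h₂, h0, sq_nonneg]
  rw [baseNorm, hsplit]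
  refine (kSpace_le ht _ _).trans (add_le_add ?_ (mul_le_mul_of_nonneg_left ?_ (Real.sqrt_nonneg _)))
  · refine Real.iSup_le (fun j => ?_) hl
    rw [opNorm_eq_norm, norm_of_const, Complex.norm_real]
    exact hh₁ j
  · refine Real.sqrt_le_sqrt ?_
    rw [opNorm_eq_norm]
    refine (norm_sum_le _ _).trans (Finset.sum_le_sum fun j _ => ?_)
    refine (norm_mul_le _ _).trans ?_
    rw [Matrix.l2_opNorm_conjTranspose, norm_of_const, Complex.norm_real, ← sq, Real.norm_eq_abs,
      sq_abs]
    exact hh₂ j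

/-- Every pair of complete contractions bounds the minimal norm from below. -/
theorem norm_le_minNorm (N : MatNorms m) (a : Matrix (Fin m) (Fin m) ℂ) {U : MatTuple m k}
    {V : MatTuple m l} (hU : IsCompleteContraction N U) (hV : IsCompleteContraction N V) :
    ‖∑ i, ∑ j, a i j • (U i ⊗ₖ V j)‖ ≤ minNorm N a := by
  -- `‖U i‖` is bounded by the norm of `e_i` for every complete contraction, so the supremum is
  -- finite.
  let b : Fin m → ℝ := fun i => N 1 (Pi.single i 1)
  have hb : ∀ {k : ℕ} {U : MatTuple m k}, IsCompleteContraction N U → ∀ i, ‖U i‖ ≤ b i := by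
    intro k U hU i
    refine le_trans ?_ (hU 1 (Pi.single i 1))
    have h1 : amplify U (Pi.single i (1 : Matrix (Fin 1) (Fin 1) ℂ)) =
        (1 : Matrix (Fin 1) (Fin 1) ℂ) ⊗ₖ U i := by
      rw [amplify, Finset.sum_eq_single i]
      · simp
      · intro j _ hj
        simp [Pi.single_eq_of_ne hj]
      · simp
    rw [h1, opNorm_eq_norm]
    have h2 : U i = ((1 : Matrix (Fin 1) (Fin 1) ℂ) ⊗ₖ U i).submatrix
        (Equiv.uniqueProd (Fin k) (Fin 1)).symm (Equiv.uniqueProd (Fin k) (Fin 1)).symm := by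
      ext a b
      simp
    conv_lhs => rw [h2]
    exact norm_submatrix_equiv_le _ _
  rw [← opNorm_eq_norm]
  refine le_csSup ⟨∑ i, ∑ j, ‖a i j‖ * (b i * b j), ?_⟩ ⟨k, l, U, V, hU, hV, rfl⟩
  rintro r ⟨k, l, U, V, hU, hV, rfl⟩
  rw [opNorm_eq_norm]
  refine (norm_sum_le _ _).trans (Finset.sum_le_sum fun i _ => (norm_sum_le _ _).trans
    (Finset.sum_le_sum fun j _ => ?_))
  rw [norm_smul]
  refine mul_le_mul_of_nonneg_left ((norm_kronecker_le _ _).trans ?_) (norm_nonneg _)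
  exact mul_le_mul (hb hU i) (hb hV j) (norm_nonneg _) ((norm_nonneg _).trans (hb hU i))

end Spaces

/-! ### The injective norm of the image of the identity -/

variable {n m : ℕ}

/-- A net of the real sphere also controls complex vectors. -/
theorem sum_norm_sq_le_of_net {S : Finset (EuclideanSpace ℝ (Fin n))}
    (hS : ∀ v : EuclideanSpace ℝ (Fin n), ‖v‖ = 1 → ∃ ξ ∈ S, ‖v - ξ‖ ≤ 1 / 2)
    (v : Fin n → ℂ) {M : ℝ} (hM0 : 0 ≤ M)
    (hM : ∀ ξ ∈ S, ‖∑ i, (ξ i : ℂ) * v i‖ ≤ M) : ∑ i, ‖v i‖ ^ 2 ≤ 8 * M ^ 2 := by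
  have hre := norm_le_of_net hS (WithLp.toLp 2 fun i => (v i).re) hM0 fun ξ hξ => by
    refine le_trans (le_of_eq ?_) ((Complex.abs_re_le_norm _).trans (hM ξ hξ))
    simp
  have him := norm_le_of_net hS (WithLp.toLp 2 fun i => (v i).im) hM0 fun ξ hξ => by
    refine le_trans (le_of_eq ?_) ((Complex.abs_im_le_norm _).trans (hM ξ hξ))
    simp
  have h1 := pow_le_pow_left₀ (norm_nonneg _) hre 2
  have h2 := pow_le_pow_left₀ (norm_nonneg _) him 2
  rw [EuclideanSpace.real_norm_sq_eq] at h1 h2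
  have h3 : ∑ i, ‖v i‖ ^ 2 = ∑ i, (v i).re ^ 2 + ∑ i, (v i).im ^ 2 := by
    rw [← Finset.sum_add_distrib]
    refine Finset.sum_congr rfl fun i _ => ?_
    rw [← Complex.normSq_eq_norm_sq, Complex.normSq_apply]
    ring
  simp only at h1 h2
  nlinarith

theorem norm_sum_mul_sq_le {ι : Type*} (s : Finset ι) (v w : ι → ℂ) :
    ‖∑ i ∈ s, v i * w i‖ ^ 2 ≤ (∑ i ∈ s, ‖v i‖ ^ 2) * ∑ i ∈ s, ‖w i‖ ^ 2 := by
  refine le_trans (pow_le_pow_left₀ (norm_nonneg _) (norm_sum_le _ _) 2) ?_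
  simp_rw [norm_mul]
  exact Finset.sum_mul_sq_le_sq_mul_sq _ _ _

theorem sum_comb_mul (g : Fin n × Fin m → ℝ) (ξ : Fin n → ℝ) (φ : Fin m → ℂ) :
    ∑ i, (ξ i : ℂ) * ∑ j, φ j * (g (i, j) : ℂ) = ∑ j, φ j * (comb g ξ j : ℂ) := by
  simp only [comb, Complex.ofReal_sum, Complex.ofReal_mul, Finset.mul_sum]
  rw [Finset.sum_comm]
  exact Finset.sum_congr rfl fun j _ => Finset.sum_congr rfl fun i _ => by ring

/-- Contractive functionals pull back through `G` to vectors of `ℂⁿ` of squared norm at most `8M²`;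
`φ ⊗ ψ` becomes their bilinear pairing, and Cauchy–Schwarz applies. -/
theorem epsNorm_smul_imageOfIdentity_le {S : Finset (EuclideanSpace ℝ (Fin n))}
    (hS : ∀ v : EuclideanSpace ℝ (Fin n), ‖v‖ = 1 → ∃ ξ ∈ S, ‖v - ξ‖ ≤ 1 / 2)
    (N : MatNorms m) (g : Fin n × Fin m → ℝ) {M c : ℝ} (hM0 : 0 ≤ M) (hc : 0 ≤ c)
    (hM : ∀ ξ ∈ S, baseNorm N (fun j => (comb g ξ j : ℂ)) ≤ M) :
    epsNorm N ((c : ℂ) • imageOfIdentity g) ≤ c * (8 * M ^ 2) := by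
  refine Real.sSup_le ?_ (by positivity)
  rintro r ⟨φ, ψ, hφ, hψ, rfl⟩
  let V : (Fin m → ℂ) → Fin n → ℂ := fun φ i => ∑ j, φ j * (g (i, j) : ℂ)
  have hV : ∀ φ, IsContractiveFunctional N φ → ∑ i, ‖V φ i‖ ^ 2 ≤ 8 * M ^ 2 := fun φ hφ => by
    refine sum_norm_sq_le_of_net hS _ hM0 fun ξ hξ => ?_
    rw [sum_comb_mul]
    exact (hφ _).trans (hM ξ hξ)
  have heq : ∑ i, ∑ j, ((c : ℂ) • imageOfIdentity g) i j * (φ i * ψ j) =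
      c * ∑ p, V φ p * V ψ p := by
    simp only [V, imageOfIdentity, Matrix.smul_apply, Matrix.of_apply, smul_eq_mul,
      Finset.mul_sum, Finset.sum_mul]
    rw [Finset.sum_comm_cycle]
    refine Finset.sum_congr rfl fun p _ => ?_
    rw [Finset.sum_comm]
    exact Finset.sum_congr rfl fun j _ => Finset.sum_congr rfl fun i _ => by ring
  rw [heq, norm_mul, Complex.norm_real, Real.norm_of_nonneg hc]
  refine mul_le_mul_of_nonneg_left ?_ hc
  refine abs_le_of_sq_le_sq' ?_ (by positivity) |>.2
  calc _ ≤ _ := norm_sum_mul_sq_le _ _ _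
    _ ≤ (8 * M ^ 2) * (8 * M ^ 2) :=
      mul_le_mul (hV φ hφ) (hV ψ hψ) (Finset.sum_nonneg fun _ _ => by positivity) (by positivity)
    _ = _ := by ring

/-! ### Column maps as test maps for the minimal norm -/

/-- The map `e_j ↦ c • ∑ p, g (p, j) E_{p, i₀}` of `ℂ^m` into the column `i₀` of `M_n`. -/
def columnMap (i₀ : Fin n) (c : ℝ) (g : Fin n × Fin m → ℝ) : MatTuple m n := fun j =>
  Matrix.of fun p r => if r = i₀ then ((c * g (p, j) : ℝ) : ℂ) else 0

theorem columnMap_conjTranspose_mul_self (i₀ : Fin n) (c : ℝ) (g : Fin n × Fin m → ℝ) (j : Fin m) :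
    (columnMap i₀ c g j)ᴴ * columnMap i₀ c g j =
      Matrix.diagonal (Pi.single i₀ ((c ^ 2 * ∑ p, g (p, j) ^ 2 : ℝ) : ℂ)) := by
  ext a b
  rw [Matrix.mul_apply, Matrix.diagonal_apply]
  by_cases ha : a = i₀ <;> by_cases hb : b = i₀
  · subst ha hb
    simp only [columnMap, Matrix.conjTranspose_apply, Matrix.of_apply, if_true, Pi.single_eq_same]
    simp only [RCLike.star_def, Complex.conj_ofReal, ← Complex.ofReal_mul, ← Complex.ofReal_sum,
      Finset.mul_sum]
    congr 1
    exact Finset.sum_congr rfl fun p _ => by ring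
  · subst ha
    simp [columnMap, hb, Ne.symm hb]
  · simp [columnMap, ha]
  · simp [columnMap, ha, hb]

theorem norm_diagonal_single (i₀ : Fin n) (c : ℂ) :
    ‖(Matrix.diagonal (Pi.single i₀ c) : Matrix (Fin n) (Fin n) ℂ)‖ = ‖c‖ := by
  rw [Matrix.l2_opNorm_diagonal, Pi.norm_single]

theorem norm_columnMap_sq (i₀ : Fin n) (c : ℝ) (g : Fin n × Fin m → ℝ) (j : Fin m) :
    ‖columnMap i₀ c g j‖ ^ 2 = c ^ 2 * ∑ p, g (p, j) ^ 2 := by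
  rw [sq, ← Matrix.l2_opNorm_conjTranspose_mul_self, columnMap_conjTranspose_mul_self,
    norm_diagonal_single, Complex.norm_real, Real.norm_of_nonneg]
  exact mul_nonneg (sq_nonneg _) (Finset.sum_nonneg fun _ _ => sq_nonneg _)

theorem norm_sum_columnMap_col_le (i₀ : Fin n) (c : ℝ) (g : Fin n × Fin m → ℝ) :
    ‖∑ j, (columnMap i₀ c g j)ᴴ * columnMap i₀ c g j‖ ≤ c ^ 2 * ∑ j, ∑ p, g (p, j) ^ 2 := by
  refine (norm_sum_le _ _).trans (le_of_eq ?_)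
  rw [Finset.mul_sum]
  refine Finset.sum_congr rfl fun j _ => ?_
  rw [Matrix.l2_opNorm_conjTranspose_mul_self, ← sq, norm_columnMap_sq]

/-- The sum is `c² G Gᴴ`, so only the operator norm of `G` enters, whereas the column sum sees its
Hilbert–Schmidt norm. -/
theorem norm_sum_columnMap_row_le (i₀ : Fin n) (c : ℝ) (g : Fin n × Fin m → ℝ) {M : ℝ}
    (hM0 : 0 ≤ M) (hM : ∀ z : Fin m → ℂ,
      ∑ i, ‖∑ j, z j * (g (i, j) : ℂ)‖ ^ 2 ≤ M ^ 2 * ∑ j, ‖z j‖ ^ 2) :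
    ‖∑ j, columnMap i₀ c g j * (columnMap i₀ c g j)ᴴ‖ ≤ c ^ 2 * M ^ 2 := by
  let G : Matrix (Fin n) (Fin m) ℂ := Matrix.of fun i j => (g (i, j) : ℂ)
  have hG : ‖G‖ ≤ M := by
    rw [Matrix.l2_opNorm_def]
    refine ContinuousLinearMap.opNorm_le_bound _ hM0 fun z => ?_
    refine abs_le_of_sq_le_sq' ?_ (by positivity) |>.2
    rw [mul_pow, EuclideanSpace.norm_sq_eq, EuclideanSpace.norm_sq_eq]
    refine le_trans (le_of_eq ?_) (hM z)
    refine Finset.sum_congr rfl fun i _ => ?_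
    congr 2
    simp [G, Matrix.toLpLin_apply, Matrix.mulVec, dotProduct, mul_comm]
  have heq : ∑ j, columnMap i₀ c g j * (columnMap i₀ c g j)ᴴ = ((c ^ 2 : ℝ) : ℂ) • (G * Gᴴ) := by
    ext a b
    simp only [Matrix.sum_apply, Matrix.mul_apply, columnMap, Matrix.conjTranspose_apply,
      Matrix.of_apply, Matrix.smul_apply, G, smul_eq_mul, Finset.mul_sum]
    refine Finset.sum_congr rfl fun j _ => ?_
    rw [Finset.sum_eq_single i₀ (fun r _ hr => by simp [hr]) (by simp)]
    simp
    ring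
  have hGG : ‖G * Gᴴ‖ ≤ M ^ 2 := by
    refine (Matrix.l2_opNorm_mul _ _).trans ?_
    rw [Matrix.l2_opNorm_conjTranspose, ← sq]
    exact pow_le_pow_left₀ (norm_nonneg _) hG 2
  rw [heq, norm_smul, Complex.norm_real, Real.norm_of_nonneg (sq_nonneg c)]
  exact mul_le_mul_of_nonneg_left hGG (sq_nonneg c)

/-- The partial trace of a matrix along one column is controlled by its norm. -/
theorem norm_sum_diag_le (M : Matrix (Fin n × Fin n) (Fin n × Fin n) ℂ) (b : Fin n × Fin n) :
    ‖∑ p, M (p, p) b‖ ≤ √n * ‖M‖ := by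
  have h1 := M.l2_opNorm_mulVec (EuclideanSpace.single b 1)
  rw [PiLp.norm_single, norm_one, mul_one] at h1
  have h2 := pow_le_pow_left₀ (norm_nonneg _) h1 2
  rw [EuclideanSpace.norm_sq_eq] at h2
  have h3 : ∑ p : Fin n, ‖M (p, p) b‖ ^ 2 ≤ ‖M‖ ^ 2 := by
    refine le_trans ?_ h2
    rw [Fintype.sum_prod_type]
    refine Finset.sum_le_sum fun p _ => ?_
    refine le_trans (le_of_eq ?_) (Finset.single_le_sum (fun r _ => by positivity)
      (Finset.mem_univ p))
    simp
  have h4 := norm_sum_mul_sq_le Finset.univ (fun p : Fin n => M (p, p) b) (fun _ => 1)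
  simp only [mul_one, norm_one, one_pow, Finset.sum_const, Finset.card_univ, Fintype.card_fin,
    nsmul_eq_mul] at h4
  refine abs_le_of_sq_le_sq' ?_ (by positivity) |>.2
  rw [mul_pow, Real.sq_sqrt (Nat.cast_nonneg n)]
  have hn : (0 : ℝ) ≤ n := Nat.cast_nonneg n
  nlinarith

/-- The partial trace of the tensor along the column `(i₀, i₀)` is `k c²` times the squared
Hilbert–Schmidt norm of `G Gᵀ`. Keeping its diagonal entries, whose sum is `∑ g²`, Cauchy–Schwarz
costs the factor `1/n`. -/
theorem le_norm_columnMap_tensor (hn : 1 ≤ n) (i₀ : Fin n) {c k : ℝ} (hk : 0 ≤ k)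
    (g : Fin n × Fin m → ℝ) :
    k * (c ^ 2 * ((∑ p, g p ^ 2) ^ 2 / n)) ≤
      √n * ‖∑ i, ∑ j, ((k : ℂ) • imageOfIdentity g) i j •
        (columnMap i₀ c g i ⊗ₖ columnMap i₀ c g j)‖ := by
  refine le_trans ?_ (norm_sum_diag_le _ (i₀, i₀))
  have heq : ∑ p, (∑ i, ∑ j, ((k : ℂ) • imageOfIdentity g) i j •
        (columnMap i₀ c g i ⊗ₖ columnMap i₀ c g j)) (p, p) (i₀, i₀) =
      ((k * (c ^ 2 * ∑ p, ∑ s, (∑ i, g (s, i) * g (p, i)) ^ 2) : ℝ) : ℂ) := by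
    simp only [Matrix.sum_apply, Matrix.smul_apply, imageOfIdentity, Matrix.of_apply, columnMap,
      Matrix.kroneckerMap_apply, if_true, smul_eq_mul]
    push_cast
    simp only [sq (∑ i, _), Finset.mul_sum, Finset.sum_mul]
    refine Finset.sum_congr rfl fun p _ => ?_
    rw [Finset.sum_comm_cycle]
    refine Finset.sum_congr rfl fun s _ => Finset.sum_congr rfl fun i _ =>
      Finset.sum_congr rfl fun j _ => by ring
  rw [heq, Complex.norm_real]
  refine le_trans ?_ (le_abs_self _)
  have hn' : (0 : ℝ) < n := by exact_mod_cast hn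
  refine mul_le_mul_of_nonneg_left (mul_le_mul_of_nonneg_left ?_ (sq_nonneg c)) hk
  have h1 : (∑ p, g p ^ 2) ^ 2 ≤ n * ∑ p : Fin n, (∑ i, g (p, i) ^ 2) ^ 2 := by
    rw [Fintype.sum_prod_type]
    simpa using sq_sum_le_card_mul_sum_sq (s := (Finset.univ : Finset (Fin n)))
      (f := fun p => ∑ i, g (p, i) ^ 2)
  rw [div_le_iff₀ hn', mul_comm]
  refine h1.trans (mul_le_mul_of_nonneg_left (Finset.sum_le_sum fun p _ => ?_) hn'.le)
  refine le_trans (le_of_eq ?_) (Finset.single_le_sum (f := fun s => (∑ i, g (s, i) * g (p, i)) ^ 2)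
    (fun r _ => sq_nonneg _) (Finset.mem_univ p))
  simp only [sq]

/-! ### Estimates for regular matrices -/

section Regular

variable {S : Finset (EuclideanSpace ℝ (Fin n))} {l B : ℝ} {g : Fin n × Fin m → ℝ}

/-- The `j`-th coordinate of each `Gξ` is at most `l` plus its excess, hence `O(√n)`; the net turns
this into a bound on the `j`-th column. -/
theorem Regular.sum_sq_column_le
    (hS : ∀ v : EuclideanSpace ℝ (Fin n), ‖v‖ = 1 → ∃ ξ ∈ S, ‖v - ξ‖ ≤ 1 / 2)
    (hB : 0 ≤ B) (hl : l ≤ √n) (hg : Regular S l B g) (j : Fin m) :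
    ∑ p, g (p, j) ^ 2 ≤ (2 * (1 + 2 * √B)) ^ 2 * n := by
  have hM : ∀ ξ ∈ S, |∑ i, ξ i * g (i, j)| ≤ √n * (1 + 2 * √B) := fun ξ hξ => by
    have h1 : excess l (comb g ξ j) ≤ 2 * √B * √n := by
      refine abs_le_of_sq_le_sq' ?_ (by positivity) |>.2
      rw [mul_pow, mul_pow, Real.sq_sqrt hB, Real.sq_sqrt (Nat.cast_nonneg n)]
      have h2 := Finset.single_le_sum (f := fun j => excess l (comb g ξ j) ^ 2)
        (fun r _ => sq_nonneg _) (Finset.mem_univ j)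
      have h3 := hg.excess_lt ξ hξ
      simp only at h2
      linarith
    have h4 := abs_le_add_excess l (comb g ξ j)
    rw [comb] at h4 h1
    linarith
  have h := norm_le_of_net hS (WithLp.toLp 2 fun i => g (i, j)) (by positivity) hM
  have h2 := pow_le_pow_left₀ (norm_nonneg _) h 2
  rw [EuclideanSpace.real_norm_sq_eq] at h2
  refine h2.trans (le_of_eq ?_)
  rw [mul_pow, mul_pow, Real.sq_sqrt (Nat.cast_nonneg n)]
  ring

theorem Regular.sum_norm_sq_le
    (hS : ∀ v : EuclideanSpace ℝ (Fin n), ‖v‖ = 1 → ∃ ξ ∈ S, ‖v - ξ‖ ≤ 1 / 2)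
    (hg : Regular S l B g) (z : Fin m → ℂ) :
    ∑ i, ‖∑ j, z j * (g (i, j) : ℂ)‖ ^ 2 ≤ (14 * √m) ^ 2 * ∑ j, ‖z j‖ ^ 2 := by
  have hz : 0 ≤ ∑ j, ‖z j‖ ^ 2 := Finset.sum_nonneg fun _ _ => by positivity
  have h := sum_norm_sq_le_of_net hS (fun i => ∑ j, z j * (g (i, j) : ℂ))
    (M := √((∑ j, ‖z j‖ ^ 2) * (4 * (6 * m)))) (Real.sqrt_nonneg _) fun ξ hξ => by
      rw [sum_comb_mul]
      refine Real.le_sqrt_of_sq_le ((norm_sum_mul_sq_le _ _ _).trans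
        (mul_le_mul_of_nonneg_left ?_ hz))
      simp only [Complex.norm_real, Real.norm_eq_abs, sq_abs]
      exact (hg.comb_lt ξ hξ).le
  rw [Real.sq_sqrt (by positivity)] at h
  rw [mul_pow, Real.sq_sqrt (Nat.cast_nonneg m)]
  -- The constant is `8 · 24 = 192 ≤ 14²`.
  have : 0 ≤ (m : ℝ) * ∑ j, ‖z j‖ ^ 2 := by positivity
  linarith

theorem Regular.isCompleteContraction_columnMap
    (hS : ∀ v : EuclideanSpace ℝ (Fin n), ‖v‖ = 1 → ∃ ξ ∈ S, ‖v - ξ‖ ≤ 1 / 2)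
    (hB : 0 ≤ B) (hl : l ≤ √n) (hg : Regular S l B g) (hn : 1 ≤ n) (hm : 0 < m)
    (q : ℝ) (i₀ : Fin n) :
    IsCompleteContraction (xSpace q ((n : ℝ) / m) m)
      (columnMap i₀ (((n : ℝ) / m) ^ (-1 / q) / ((14 + 2 * (1 + 2 * √B)) * m)) g) := by
  have hn' : (1 : ℝ) ≤ n := by exact_mod_cast hn
  have hm' : (0 : ℝ) < m := by exact_mod_cast hm
  have ht : 0 < (n : ℝ) / m := by positivity
  set a : ℝ := ((n : ℝ) / m) ^ (-1 / q) with ha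
  have ha0 : 0 < a := Real.rpow_pos_of_pos ht _
  set b : ℝ := 2 * (1 + 2 * √B) with hb
  have hb0 : 0 ≤ b := by positivity
  -- The denominator dominates both the row constant `14` and the column constant `b`.
  set c : ℝ := a / ((14 + b) * m) with hc
  have hcol : ∀ j, ∑ p, g (p, j) ^ 2 ≤ b ^ 2 * n := hg.sum_sq_column_le hS hB hl
  have hc0 : 0 ≤ c := by positivity
  have hcb : c * b ≤ a / m := by
    rw [hc, div_mul_eq_mul_div, div_le_div_iff₀ (by positivity) hm']
    have : 0 < a * m := by positivity
    nlinarith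
  have hc14 : c * 14 ≤ a / m := by
    rw [hc, div_mul_eq_mul_div, div_le_div_iff₀ (by positivity) hm']
    have : 0 ≤ a * m * b := by positivity
    nlinarith
  have hcb2 : c ^ 2 * b ^ 2 ≤ (a / m) ^ 2 := by
    rw [← mul_pow]; exact pow_le_pow_left₀ (by positivity) hcb 2
  have hc142 : c ^ 2 * 14 ^ 2 ≤ (a / m) ^ 2 := by
    rw [← mul_pow]; exact pow_le_pow_left₀ (by positivity) hc14 2
  refine isCompleteContraction_xSpace ht hm ?_ _ ?_ ?_ fun j => ?_
  · rwa [div_mul_cancel₀ _ hm'.ne']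
  · refine (norm_sum_columnMap_col_le i₀ c g).trans ?_
    have h1 : ∑ j : Fin m, ∑ p, g (p, j) ^ 2 ≤ m * (b ^ 2 * n) := by
      refine (Finset.sum_le_sum fun j _ => hcol j).trans (le_of_eq ?_)
      simp
    calc c ^ 2 * ∑ j, ∑ p, g (p, j) ^ 2 ≤ c ^ 2 * (m * (b ^ 2 * n)) := by gcongr
      _ = (c ^ 2 * b ^ 2) * (m * n) := by ring
      _ ≤ (a / m) ^ 2 * (m * n) := by gcongr
      _ = a ^ 2 * (n / m) := by field_simp
  · refine (norm_sum_columnMap_row_le i₀ c g (by positivity) (hg.sum_norm_sq_le hS)).trans ?_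
    calc c ^ 2 * (14 * √m) ^ 2 = (c ^ 2 * 14 ^ 2) * m := by
          rw [mul_pow, Real.sq_sqrt hm'.le]; ring
      _ ≤ (a / m) ^ 2 * m := by gcongr
      _ = a ^ 2 / m := by field_simp
  · refine abs_le_of_sq_le_sq' ?_ (by positivity) |>.2
    rw [norm_columnMap_sq]
    calc c ^ 2 * ∑ p, g (p, j) ^ 2 ≤ c ^ 2 * (b ^ 2 * n) :=
          mul_le_mul_of_nonneg_left (hcol j) (sq_nonneg c)
      _ = (c ^ 2 * b ^ 2) * n := by ring
      _ ≤ (a / m) ^ 2 * (n * n) := by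
          refine mul_le_mul hcb2 ?_ (by positivity) (by positivity)
          nlinarith
      _ = (a * (n / m)) ^ 2 := by field_simp

theorem rpow_neg_mul_rpow_neg {q x y : ℝ} (hx : 0 < x) (hy : 0 < y) :
    y ^ (-2 / q) * ((x / y) ^ (-1 / q)) ^ 2 = x ^ (-2 / q) := by
  have h : ((x / y) ^ (-1 / q)) ^ 2 = (x / y) ^ (-2 / q) := by
    rw [← Real.rpow_natCast, ← Real.rpow_mul (by positivity)]
    congr 1
    push_cast
    ring
  rw [h, ← Real.mul_rpow hy.le (by positivity)]
  congr 1
  field_simp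

/-- The scalar is chosen to cancel the loss `5000²` in the lower bound for `(∑ g²)²` and the
normalisation of the two column maps. -/
theorem Regular.minNorm_ge
    (hS : ∀ v : EuclideanSpace ℝ (Fin n), ‖v‖ = 1 → ∃ ξ ∈ S, ‖v - ξ‖ ≤ 1 / 2)
    (hB : 0 ≤ B) (hl : l ≤ √n) (hg : Regular S l B g) (hn : 1 ≤ n) (hm : 0 < m)
    (q : ℝ) :
    (n : ℝ) ^ (1 / 2 - 2 / q) ≤ minNorm (xSpace q ((n : ℝ) / m) m)
      (((5000 ^ 2 * (14 + 2 * (1 + 2 * √B)) ^ 2 * (m : ℝ) ^ (-2 / q) : ℝ) : ℂ) •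
        imageOfIdentity g) := by
  have hn' : (0 : ℝ) < n := by exact_mod_cast hn
  have hm' : (0 : ℝ) < m := by exact_mod_cast hm
  set C : ℝ := 14 + 2 * (1 + 2 * √B) with hC
  have hC0 : 0 < C := by positivity
  set a : ℝ := ((n : ℝ) / m) ^ (-1 / q) with ha
  set k : ℝ := 5000 ^ 2 * C ^ 2 * (m : ℝ) ^ (-2 / q) with hk
  have hU := hg.isCompleteContraction_columnMap hS hB hl hn hm q ⟨0, hn⟩
  rw [← ha, ← hC] at hU
  refine le_trans ?_ (norm_le_minNorm _ _ hU hU)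
  have h1 := le_norm_columnMap_tensor hn ⟨0, hn⟩ (c := a / (C * m)) (k := k) (by positivity) g
  have hs : 0 < √(n : ℝ) := Real.sqrt_pos.2 hn'
  rw [← mul_le_mul_iff_of_pos_left hs]
  refine le_trans ?_ h1
  have h2 : ((n : ℝ) * m / 5000) ^ 2 ≤ (∑ p, g p ^ 2) ^ 2 :=
    pow_le_pow_left₀ (by positivity) hg.lt_sum.le 2
  have h3 : (m : ℝ) ^ (-2 / q) * a ^ 2 = (n : ℝ) ^ (-2 / q) := rpow_neg_mul_rpow_neg hn' hm'
  have h4 : √(n : ℝ) * (n : ℝ) ^ (1 / 2 - 2 / q) = n * (n : ℝ) ^ (-2 / q) := by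
    rw [Real.sqrt_eq_rpow, ← Real.rpow_add hn']
    nth_rewrite 2 [← Real.rpow_one (n : ℝ)]
    rw [← Real.rpow_add hn']
    congr 1
    ring
  calc √(n : ℝ) * (n : ℝ) ^ (1 / 2 - 2 / q) = n * ((m : ℝ) ^ (-2 / q) * a ^ 2) := by rw [h4, h3]
    _ = k * ((a / (C * m)) ^ 2 * (((n : ℝ) * m / 5000) ^ 2 / n)) := by
        rw [hk]; field_simp
    _ ≤ _ := by gcongr

theorem Regular.epsNorm_le
    (hS : ∀ v : EuclideanSpace ℝ (Fin n), ‖v‖ = 1 → ∃ ξ ∈ S, ‖v - ξ‖ ≤ 1 / 2) {q : ℝ} (hq : 2 < q)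
    (hB : 0 ≤ B) (hg : Regular S ((n : ℝ) ^ (1 / q)) B g) (hn : 1 ≤ n)
    (hnm : (n : ℝ) ^ (q / 2) ≤ m) {k : ℝ} (hk : 0 ≤ k) :
    epsNorm (xSpace q ((n : ℝ) / m) m) (((k * (m : ℝ) ^ (-2 / q) : ℝ) : ℂ) • imageOfIdentity g) ≤
      k * (8 * (1 + 2 * √B) ^ 2) := by
  have hn' : (1 : ℝ) ≤ n := by exact_mod_cast hn
  have hn0 : (0 : ℝ) < n := by linarith
  have hm' : (0 : ℝ) < m := (Real.rpow_pos_of_pos hn0 _).trans_le hnm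
  set t : ℝ := (n : ℝ) / m with ht
  have ht0 : 0 < t := by positivity
  set l : ℝ := (n : ℝ) ^ (1 / q) with hl
  have hl0 : 0 ≤ l := by positivity
  -- Squared, this is `n²/m ≤ n^{2/q}`; as `m ≥ n^{q/2}` it reduces to `2 ≤ 2/q + q/2`, i.e. `(q -
  -- 2)² ≥ 0`.
  have hdecay : √t * √n ≤ l := by
    refine abs_le_of_sq_le_sq' ?_ hl0 |>.2
    rw [mul_pow, Real.sq_sqrt ht0.le, Real.sq_sqrt hn0.le, ht, div_mul_eq_mul_div,
      div_le_iff₀ hm']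
    have h1 : l ^ 2 = (n : ℝ) ^ (2 / q) := by
      rw [hl, ← Real.rpow_natCast, ← Real.rpow_mul hn0.le]
      congr 1
      push_cast
      ring
    have h2 : (n : ℝ) * n = (n : ℝ) ^ (2 : ℝ) := by
      rw [Real.rpow_two, sq]
    rw [h1, h2]
    refine le_trans ?_ (mul_le_mul_of_nonneg_left hnm (by positivity))
    rw [← Real.rpow_add hn0]
    refine Real.rpow_le_rpow_of_exponent_le hn' ?_
    have hq0 : 0 < q := by linarith
    rw [div_add_div _ _ hq0.ne' two_ne_zero, le_div_iff₀ (by positivity)]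
    nlinarith [sq_nonneg (q - 2)]
  have hM : ∀ ξ ∈ S, baseNorm (xSpace q t m) (fun j => (comb g ξ j : ℂ)) ≤
      t ^ (-1 / q) * (l * (1 + 2 * √B)) := fun ξ hξ => by
    refine mul_le_mul_of_nonneg_left ?_ (by positivity)
    refine (baseNorm_kSpace_le ht0.le hl0 (comb g ξ)).trans ?_
    have h1 : √(∑ j, excess l (comb g ξ j) ^ 2) ≤ 2 * √B * √n := by
      refine Real.sqrt_le_iff.2 ⟨by positivity, ?_⟩
      rw [mul_pow, mul_pow, Real.sq_sqrt hB, Real.sq_sqrt hn0.le]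
      linarith [hg.excess_lt ξ hξ]
    have h2 := mul_le_mul_of_nonneg_left h1 (Real.sqrt_nonneg t)
    have h3 := mul_le_mul_of_nonneg_left hdecay (by positivity : 0 ≤ 2 * √B)
    linarith
  refine (epsNorm_smul_imageOfIdentity_le hS _ g (by positivity) (by positivity) hM).trans
    (le_of_eq ?_)
  have h3 : (m : ℝ) ^ (-2 / q) * (t ^ (-1 / q)) ^ 2 = (n : ℝ) ^ (-2 / q) :=
    rpow_neg_mul_rpow_neg hn0 hm'
  have h4 : (n : ℝ) ^ (-2 / q) * l ^ 2 = 1 := by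
    rw [hl, ← Real.rpow_natCast, ← Real.rpow_mul hn0.le, ← Real.rpow_add hn0]
    convert Real.rpow_zero (n : ℝ) using 2
    push_cast
    ring
  calc _ = k * (8 * (1 + 2 * √B) ^ 2) * (((m : ℝ) ^ (-2 / q) * (t ^ (-1 / q)) ^ 2) * l ^ 2) := by
        ring
    _ = _ := by rw [h3, h4, mul_one]

end Regular

end OpSpace

/-! ### Choice of constants and conclusion -/

theorem mainTheorem5 (q : ℝ) (hq : 2 < q) :
    ∃ D κ : ℝ, 0 < D ∧ 0 < κ ∧ ∀ n m : ℕ, 1 ≤ n →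
      (n : ℝ) ^ (q / 2) ≤ m → (m : ℝ) ≤ 2 * (n : ℝ) ^ (q / 2) →
      (∃ a : Matrix (Fin m) (Fin m) ℂ, OpSpace.Separates q D n m a) ∧
      0 < OpSpace.gaussianMatrix n m
        {g | OpSpace.Separates q D n m
          (((κ * (m : ℝ) ^ (-2 / q) : ℝ) : ℂ) • OpSpace.imageOfIdentity g)} := by
  set K : ℝ := 2 * (q ^ 2) ^ (q ^ 2 / 4) with hK
  have hK0 : 0 ≤ K := by positivity
  set B : ℝ := 2 * K + 4 with hB
  have hB0 : 0 ≤ B := by positivity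
  set κ : ℝ := 5000 ^ 2 * (14 + 2 * (1 + 2 * √B)) ^ 2 with hκ
  have hκ0 : 0 < κ := by positivity
  refine ⟨κ * (8 * (1 + 2 * √B) ^ 2), κ, by positivity, hκ0, fun n m hn h1 h2 => ?_⟩
  have hn' : (1 : ℝ) ≤ n := by exact_mod_cast hn
  have hnm : n ≤ m := by
    have h : (n : ℝ) ≤ m := by
      refine le_trans ?_ h1
      conv_lhs => rw [← Real.rpow_one (n : ℝ)]
      exact Real.rpow_le_rpow_of_exponent_le hn' (by linarith)
    exact_mod_cast h
  have hm : 0 < m := by omega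
  have hm' : (0 : ℝ) < m := by exact_mod_cast hm
  have hl0 : 0 ≤ (n : ℝ) ^ (1 / q) := by positivity
  have hl : (n : ℝ) ^ (1 / q) ≤ √n := by
    rw [Real.sqrt_eq_rpow]
    exact Real.rpow_le_rpow_of_exponent_le hn' (one_div_le_one_div_of_le two_pos hq.le)
  obtain ⟨S, hcard, hunit, hnet⟩ := OpSpace.exists_net n
  have hreg := OpSpace.exists_regular hn hnm hcard hunit hl0 hK0 (OpSpace.rpow_mul_exp_le hq hn h2)
  have hpos := OpSpace.measure_regular_and_rank_pos hnm hreg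
  have hsub : {g : Fin n × Fin m → ℝ | OpSpace.Regular S ((n : ℝ) ^ (1 / q)) B g ∧
      ((Matrix.of fun i j => g (i, j) : Matrix (Fin n) (Fin m) ℝ).submatrix id
        (Fin.castLE hnm)).det ≠ 0} ⊆
      {g | OpSpace.Separates q (κ * (8 * (1 + 2 * √B) ^ 2)) n m
        (((κ * (m : ℝ) ^ (-2 / q) : ℝ) : ℂ) • OpSpace.imageOfIdentity g)} := by
    rintro g ⟨hg, hdet⟩
    refine ⟨OpSpace.rank_smul_imageOfIdentity hnm ?_ hdet,
      hg.epsNorm_le hnet hq hB0 hn h1 hκ0.le, hg.minNorm_ge hnet hB0 hl hn hm q⟩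
    exact Complex.ofReal_ne_zero.2 (by positivity)
  have hpos' := hpos.trans_le (measure_mono hsub)
  refine ⟨?_, hpos'⟩
  -- A set of positive measure is nonempty, so any such `g` gives the tensor.
  obtain ⟨g, hg⟩ := nonempty_of_measure_ne_zero hpos'.ne'
  exact ⟨_, hg⟩
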